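/- **Setting.** For a decomposable (chordal) graph $G=(V,E)$ let $C_1,\dots,C_r$ be a perfect order $\mathcal P$ of its cliques (maximal complete sets), $H_j=C_1\cup\dots\cup C_j$, and $S_j=C_j\cap H_{j-1}$ ($2\le j\le r$) the separators. Let $I_G$ be the space of symmetric $G$-incomplete matrices (real entries at the edges and on the diagonal) with coordinate Lebesgue measure $d\Sigma^E$, and $Q_G\subset I_G$ the set of those $\Sigma^E$ for which $\Sigma_C$ is positive definite for every clique $C$. Each $\Sigma^E\in Q_G$ is identified with its unique positive definite completion $\Sigma$ such that $(\Sigma^{-1})_{ij}=0$ for all non-adjacent $i\ne j$. For $\alpha$ real-valued on cliques and $\beta$ real-valued on separators (write $\alpha_j=\alpha(C_j)$, $\beta_j=\beta(S_j)$) put $$H_G(\alpha,\beta,\Sigma^E)=\frac{\prod_{j=1}^r\det(\Sigma_{C_j})^{\alpha_j}}{\prod_{j=2}^r\det(\Sigma_{S_j})^{\beta_j}},\qquad \mu_G(d\Sigma^E)=H_G\Big(-\tfrac{c+1}2,-\tfrac{s+1}2,\Sigma^E\Big)d\Sigma^E,$$ where $c_j=|C_j|$, $s_j=|S_j|$, and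 $$I(\alpha,\beta,U^E)=\int_{Q_G}e^{-\operatorname{tr}(\Sigma U^{-1})}H_G(\alpha,\beta,\Sigma^E)\,\mu_G(d\Sigma^E)\qquad(U^E\in Q_G).$$ $\mathcal A$ is the set of $(\alpha,\beta)$ such that (A1) $I(\alpha,\beta,U^E)<\infty$ for every $U^E\in Q_G$ and (A2) $I(\alpha,\beta,U^E)/H_G(\alpha,\beta,U^E)$ does not depend on $U^E\in Q_G$. For a perfect order $\mathcal P$ with $r\ge2$, a separator $S$, $J(\mathcal P,S)=\{j:S_j=S\}$ and $\nu(S)=|J(\mathcal P,S)|$, put $\delta_S=\sum_{j\in J(\mathcal P,S)}\alpha_j-\nu(S)\beta(S)$. The set $A_{\mathcal P}$ consists of the $(\alpha,\beta)$ with $\delta_S=0$ for every separator $S\ne S_2$, $\alpha_j>(c_j-1)/2$ for $1\le j\le r$, and $\alpha_1+\delta_{S_2}>(s_2-1)/2$. A decomposable graph is homogeneous if the closed neighbourhoods of any two adjacent vertices are nested. Part (I) of the Letac–Massam conjecture asserts $\bigcup_{\mathcal P}A_{\mathcal P}=\mathcal A$ for every non-homogeneous decomposable graph, $\mathcal P$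 running over all perfect orders of the cliques. For a DAG with parent sets $\mathrm{pa}(j)$, $pa_j=|\mathrm{pa}(j)|$, put $\Sigma_{jj|\mathrm{pa}(j)}=\Sigma_{jj}-\Sigma_{j,\mathrm{pa}(j)}(\Sigma_{\mathrm{pa}(j)})^{-1}\Sigma_{\mathrm{pa}(j),j}$, and for $\lambda\in\mathbb R^V$ let $$R(\lambda,U^E)=\int_{Q_G}e^{-\operatorname{tr}(\Sigma U^{-1})}\prod_{j}\Sigma_{jj|\mathrm{pa}(j)}^{\lambda_j}\ \prod_{j}\Sigma_{jj|\mathrm{pa}(j)}^{-\frac{pa_j+2}2}\det(\Sigma_{\mathrm{pa}(j)})^{-\frac12}\,d\Sigma^E$$ be the generalized Riesz integral. **Statement.** Let $G$ be the graph on $\{1,\dots,8\}$ with edges $15,16,25,26,56,37,38,47,48,78,68$, with the perfect order $(\{4,7,8\},\{3,7,8\},\{6,8\},\{2,5,6\},\{1,5,6\})$ of its cliques (separators $S_2=\{7,8\}$, $S_3=\{8\}$, $S_4=\{6\}$, $S_5=\{5,6\}$), and the DAG with $\mathrm{pa}(1)=\mathrm{pa}(2)=\{5,6\}$, $\mathrm{pa}(3)=\mathrm{pa}(4)=\{7,8\}$,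 $\mathrm{pa}(5)=\{6\}$, $\mathrm{pa}(6)=\mathrm{pa}(7)=\{8\}$, $\mathrm{pa}(8)=\emptyset$. Put $$\lambda=(\alpha_5,\ \alpha_4,\ \alpha_2,\ \alpha_1,\ \alpha_4+\alpha_5-\beta_5,\ \alpha_3,\ \alpha_1+\alpha_2-\beta_2,\ \alpha_1+\alpha_2+\alpha_3-\beta_2-\beta_3).$$ Then: 1. $G$ is decomposable and not homogeneous, and the DAG is a perfect DAG version of $G$ induced by this order (every $H_j$ is ancestral). 2. On $Q_G$, $H_G(-\frac{c+1}2,-\frac{s+1}2,\Sigma^E)=\prod_j\Sigma_{jj|\mathrm{pa}(j)}^{-\frac{pa_j+2}2}\det(\Sigma_{\mathrm{pa}(j)})^{-\frac12}$, and for all $(\alpha,\beta)\in\mathbb R^5\times\mathbb R^4$, $H_G(\alpha,\beta,\Sigma^E)=\prod_j\Sigma_{jj|\mathrm{pa}(j)}^{\lambda_j}\cdot\Sigma_{66}^{\alpha_4+\alpha_5-\beta_4-\beta_5}$. 3. If $\alpha_4+\alpha_5-\beta_4-\beta_5=0$, then for every $U^E\in Q_G$ we have $I(\alpha,\beta,U^E)=R(\lambda,U^E)$,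 and this is finite if and only if $\lambda_j>pa_j/2$ for all $j$. If moreover $\lambda_j>pa_j/2$ for all $j$, there is a constant $K>0$ depending only on $(\alpha,\beta)$ such that $I(\alpha,\beta,U^E)=K\,H_G(\alpha,\beta,U^E)$ for all $U^E\in Q_G$; hence (A1) and (A2) hold. 4. $\dim\mathcal A\ge 8$, whereas $\dim\bigcup_{\mathcal P}A_{\mathcal P}=6$ (Hausdorff dimension). Hence $\mathcal A\not\subseteq\bigcup_{\mathcal P}A_{\mathcal P}$, and part (I) of the Letac–Massam conjecture is false. -/

import Mathlib

open MeasureTheory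
open scoped ENNReal Matrix

/-! ### Decomposable graphs, perfect orders of the cliques, DAG versions -/

section Graphs

variable {V : Type*} [Fintype V] [DecidableEq V]

/-- Decomposable (= chordal) graphs: no cycle of length at least four is an induced subgraph. -/
def IsDecomposable (G : SimpleGraph V) : Prop :=
  ∀ n : ℕ, 4 ≤ n → IsEmpty (SimpleGraph.cycleGraph n ↪g G)

/-- Homogeneous graphs: decomposable, and the closed neighbourhoods of any two adjacent vertices
are nested. -/
def IsHomogeneous (G : SimpleGraph V) : Prop :=
  IsDecomposable G ∧ ∀ i j : V, G.Adj i j →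
    insert j (G.neighborSet j) ⊆ insert i (G.neighborSet i) ∨
      insert i (G.neighborSet i) ⊆ insert j (G.neighborSet j)

/-- A clique is a complete set of vertices that is maximal for inclusion. -/
def IsMaxClique (G : SimpleGraph V) (C : Finset V) : Prop :=
  Maximal (fun s : Finset V => G.IsClique (s : Set V)) C

/-- The history `C 0 ∪ ⋯ ∪ C j` of a sequence of vertex sets. -/
def historyOf {m : ℕ} (C : Fin (m + 1) → Finset V) (j : Fin (m + 1)) : Finset V :=
  (Finset.univ.filter (fun k => k ≤ j)).biUnion C

/-- The `m` separators of a sequence of `m + 1` vertex sets: with the cliques numbered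
`C₁, …, C_{m+1}`, the value at `i = 0, …, m - 1` is `S_{i+2} = C_{i+2} ∩ H_{i+1}`. -/
def separatorOf {m : ℕ} (C : Fin (m + 1) → Finset V) (i : Fin m) : Finset V :=
  C i.succ ∩ historyOf C i.castSucc

/-- A perfect order of the cliques of a graph with `r = m + 1` cliques. -/
structure PerfectOrder (G : SimpleGraph V) (m : ℕ) where
  C : Fin (m + 1) → Finset V
  injective : Function.Injective C
  isMaxClique_iff : ∀ s : Finset V, IsMaxClique G s ↔ ∃ j, C j = s
  running : ∀ i : Fin m, ∃ k : Fin (m + 1), k ≤ i.castSucc ∧ separatorOf C i ⊆ C k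

/-- The index set of the parameter `α`: the cliques of `G`. -/
def CliqueIdx (G : SimpleGraph V) : Type _ := {C : Finset V // IsMaxClique G C}

/-- The index set of the parameter `β`: the (distinct) separators of `G`. -/
def SepIdx (G : SimpleGraph V) : Type _ :=
  {S : Finset V // ∃ (m : ℕ) (P : PerfectOrder G m) (i : Fin m), separatorOf P.C i = S}

instance (G : SimpleGraph V) : Finite (CliqueIdx G) :=
  inferInstanceAs (Finite {C : Finset V // IsMaxClique G C})

instance (G : SimpleGraph V) : Finite (SepIdx G) :=
  inferInstanceAs (Finite {S : Finset V //
    ∃ (m : ℕ) (P : PerfectOrder G m) (i : Fin m), separatorOf P.C i = S})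

noncomputable instance (G : SimpleGraph V) : Fintype (CliqueIdx G) := Fintype.ofFinite _

noncomputable instance (G : SimpleGraph V) : Fintype (SepIdx G) := Fintype.ofFinite _

/-- Multi-shape parameters `(α, β)`: `α` is indexed by the cliques, `β` by the separators. -/
abbrev ShapeParam (G : SimpleGraph V) : Type _ := (CliqueIdx G → ℝ) × (SepIdx G → ℝ)

namespace PerfectOrder

variable {G : SimpleGraph V} {m : ℕ}

def clique (P : PerfectOrder G m) (j : Fin (m + 1)) : CliqueIdx G :=
  ⟨P.C j, (P.isMaxClique_iff _).2 ⟨j, rfl⟩⟩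

def sep (P : PerfectOrder G m) (i : Fin m) : SepIdx G :=
  ⟨separatorOf P.C i, m, P, i, rfl⟩

end PerfectOrder

/-- A DAG on `V` is given by its parent sets `pa`; a set is ancestral if it contains the parents of
its members. -/
def IsAncestral (pa : V → Finset V) (A : Finset V) : Prop := ∀ v ∈ A, pa v ⊆ A

/-- `pa` is an acyclic orientation of `G`. -/
def IsDAGVersion (pa : V → Finset V) (G : SimpleGraph V) : Prop :=
  (∀ v, ¬ Relation.TransGen (fun a b => a ∈ pa b) v v) ∧
    ∀ v w, G.Adj v w ↔ v ∈ pa w ∨ w ∈ pa v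

/-- No immoralities: any two distinct parents of a vertex are adjacent. -/
def IsPerfectDAG (pa : V → Finset V) : Prop :=
  ∀ v, ∀ a ∈ pa v, ∀ b ∈ pa v, a ≠ b → a ∈ pa b ∨ b ∈ pa a

/-- The DAG is induced by the perfect order `P`: the histories of `P` are ancestral. -/
def IsInducedBy {G : SimpleGraph V} {m : ℕ} (pa : V → Finset V) (P : PerfectOrder G m) : Prop :=
  ∀ j, IsAncestral pa (historyOf P.C j)

end Graphs

/-! ### Incomplete matrices, Markov ratios and Type I Wishart integrals -/

noncomputable section Wishart

variable {V : Type*} [Fintype V] [DecidableEq V]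

/-- The edges of `G`, all loops included. -/
def EdgeIdx (G : SimpleGraph V) : Type _ := {e : Sym2 V // e.IsDiag ∨ e ∈ G.edgeSet}

instance (G : SimpleGraph V) : Finite (EdgeIdx G) :=
  inferInstanceAs (Finite {e : Sym2 V // e.IsDiag ∨ e ∈ G.edgeSet})

instance (G : SimpleGraph V) : Fintype (EdgeIdx G) := Fintype.ofFinite _

/-- The space `I_G` of symmetric `G`-incomplete matrices, one real coordinate for every edge or
loop; its `volume` is Lebesgue measure in these coordinates. -/
abbrev IncompleteMatrix (G : SimpleGraph V) : Type _ := EdgeIdx G → ℝ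

open Classical in
/-- The entries of a `G`-incomplete matrix, with zeros in the unspecified positions. -/
def IncompleteMatrix.toMatrix {G : SimpleGraph V} (Γ : IncompleteMatrix G) : Matrix V V ℝ :=
  Matrix.of fun i j =>
    if h : s(i, j).IsDiag ∨ s(i, j) ∈ G.edgeSet then Γ ⟨s(i, j), h⟩ else 0

/-- The principal submatrix `M_A`. -/
def principal (M : Matrix V V ℝ) (A : Finset V) : Matrix A A ℝ :=
  M.submatrix Subtype.val Subtype.val

/-- `Q_G`: the partial positive definite matrices over `G`. -/
def coneQ (G : SimpleGraph V) : Set (IncompleteMatrix G) :=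
  {Γ | ∀ C : Finset V, IsMaxClique G C → (principal Γ.toMatrix C).PosDef}

/-- `M` is a completion of `Γ` in `PD_G`: a positive definite matrix with the entries of `Γ` on
the edges and with an inverse that vanishes off the edges. -/
def IsCompletion {G : SimpleGraph V} (Γ : IncompleteMatrix G) (M : Matrix V V ℝ) : Prop :=
  M.PosDef ∧ (∀ i j, i = j ∨ G.Adj i j → M i j = Γ.toMatrix i j) ∧
    ∀ i j, i ≠ j → ¬ G.Adj i j → M⁻¹ i j = 0

open Classical in
/-- The completion of `Γ` in `PD_G`; for `G` decomposable and `Γ ∈ Q_G` it exists and is unique. -/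
def completion {G : SimpleGraph V} (Γ : IncompleteMatrix G) : Matrix V V ℝ :=
  if h : ∃ M, IsCompletion Γ M then h.choose else 0

variable {G : SimpleGraph V} {m : ℕ}

/-- The Markov ratio `H_G(α, β, Γ)`. -/
def markovRatio (P : PerfectOrder G m) (θ : ShapeParam G) (Γ : IncompleteMatrix G) : ℝ :=
  (∏ j : Fin (m + 1), (principal Γ.toMatrix (P.C j)).det ^ θ.1 (P.clique j)) /
    ∏ i : Fin m, (principal Γ.toMatrix (separatorOf P.C i)).det ^ θ.2 (P.sep i)

/-- The parameter `(-(c + 1) / 2, -(s + 1) / 2)`. -/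
def baseParam (G : SimpleGraph V) : ShapeParam G :=
  (fun C => -((C.1.card : ℝ) + 1) / 2, fun S => -((S.1.card : ℝ) + 1) / 2)

/-- The measure `μ_G(dΣ) = H_G(-(c + 1) / 2, -(s + 1) / 2, Σ) dΣ` on `Q_G`. -/
def muG (P : PerfectOrder G m) : Measure (IncompleteMatrix G) :=
  ((volume : Measure (IncompleteMatrix G)).restrict (coneQ G)).withDensity
    fun Γ => ENNReal.ofReal (markovRatio P (baseParam G) Γ)

/-- `exp(-tr(Σ U⁻¹))`, where `Σ` and `U` are the completions of `Γ` and `Υ`. -/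
def expTrace (Υ Γ : IncompleteMatrix G) : ℝ :=
  Real.exp (-(completion Γ * (completion Υ)⁻¹).trace)

/-- The Type I Wishart integral `∫_{Q_G} exp(-tr(Σ U⁻¹)) H_G(α, β, Σ) μ_G(dΣ)`. -/
def wishartIntegral (P : PerfectOrder G m) (θ : ShapeParam G) (Υ : IncompleteMatrix G) : ℝ≥0∞ :=
  ∫⁻ Γ, ENNReal.ofReal (expTrace Υ Γ * markovRatio P θ Γ) ∂(muG P)

/-- Condition (A1). -/
def CondA1 (P : PerfectOrder G m) (θ : ShapeParam G) : Prop :=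
  ∀ Υ ∈ coneQ G, wishartIntegral P θ Υ < ∞

/-- Condition (A2). -/
def CondA2 (P : PerfectOrder G m) (θ : ShapeParam G) : Prop :=
  ∀ Υ ∈ coneQ G, ∀ Υ' ∈ coneQ G,
    wishartIntegral P θ Υ / ENNReal.ofReal (markovRatio P θ Υ) =
      wishartIntegral P θ Υ' / ENNReal.ofReal (markovRatio P θ Υ')

/-- The set `𝓐` of the shape parameters of the Type I Wishart distributions. The Markov ratio, and
hence the set, is the same for all perfect orders of the cliques of `G`. -/
def setA (P : PerfectOrder G m) : Set (ShapeParam G) :=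
  {θ | CondA1 P θ ∧ CondA2 P θ}

open Classical in
/-- `∑_{j ∈ J(P, S)} α_j - ν(S) β(S)`, where `J(P, S) = {j : S_j = S}` has `ν(S)` elements. -/
def sepDefect (P : PerfectOrder G m) (θ : ShapeParam G) (S : SepIdx G) : ℝ :=
  (∑ i ∈ Finset.univ.filter (fun i : Fin m => P.sep i = S), θ.1 (P.clique i.succ)) -
    ((Finset.univ.filter (fun i : Fin m => P.sep i = S)).card : ℝ) * θ.2 S

/-- The set `A_P` of a perfect order `P` with at least two cliques. -/
def setAP (P : PerfectOrder G (m + 1)) : Set (ShapeParam G) :=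
  {θ | (∀ S : SepIdx G, S ≠ P.sep 0 → sepDefect P θ S = 0) ∧
    (∀ j, 0 < θ.1 (P.clique j) - (((P.C j).card : ℝ) - 1) / 2) ∧
    (((separatorOf P.C 0).card : ℝ) - 1) / 2 < θ.1 (P.clique 0) + sepDefect P θ (P.sep 0)}

/-- The union of the sets `A_P` over all perfect orders of the cliques of `G`. -/
def unionAP (G : SimpleGraph V) : Set (ShapeParam G) :=
  ⋃ (m : ℕ) (P : PerfectOrder G (m + 1)), setAP P

/-- The conditional variance `M_{jj | A} = M_{jj} - M_{j,A} (M_A)⁻¹ M_{A,j}`. -/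
def condVar (M : Matrix V V ℝ) (j : V) (A : Finset V) : ℝ :=
  M j j - (fun a : A => M j a) ⬝ᵥ ((principal M A)⁻¹ *ᵥ fun a : A => M a j)

/-- The base density `∏_j (Σ_{jj | pa j})^{-(pa_j + 2) / 2} det(Σ_{pa j})^{-1/2}`. -/
def rieszBase (pa : V → Finset V) (M : Matrix V V ℝ) : ℝ :=
  ∏ j, condVar M j (pa j) ^ (-(((pa j).card : ℝ) + 2) / 2) *
    (principal M (pa j)).det ^ (-(1 / 2) : ℝ)

/-- The generalized Riesz integral on `Q_G` of a DAG version of `G`. -/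
def rieszIntegral (pa : V → Finset V) (lam : V → ℝ) (Υ : IncompleteMatrix G) : ℝ≥0∞ :=
  ∫⁻ Γ in coneQ G, ENNReal.ofReal (expTrace Υ Γ *
    (∏ j, condVar Γ.toMatrix j (pa j) ^ lam j) * rieszBase pa Γ.toMatrix)

end Wishart

/-- Part (I) of the Letac-Massam conjecture: for every non-homogeneous decomposable graph, `𝓐` is
the union of the sets `A_P`. -/
def LetacMassamConjectureI : Prop :=
  ∀ (p : ℕ) (G : SimpleGraph (Fin p)), IsDecomposable G → ¬ IsHomogeneous G →
    ∀ (m : ℕ) (P : PerfectOrder G m), unionAP G = setA P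

/-! ### The graph on eight vertices

The vertex labelled `k = 1, …, 8` is the element `k - 1` of `Fin 8`. -/

section Example

/-- Edges `15, 16, 25, 26, 56, 37, 38, 47, 48, 78, 68`. -/
def exGraph : SimpleGraph (Fin 8) :=
  SimpleGraph.fromEdgeSet (({s(0, 4), s(0, 5), s(1, 4), s(1, 5), s(4, 5), s(2, 6), s(2, 7),
    s(3, 6), s(3, 7), s(6, 7), s(5, 7)} : Finset (Sym2 (Fin 8))) : Set (Sym2 (Fin 8)))

/-- Parents `pa(1) = pa(2) = {5, 6}`, `pa(3) = pa(4) = {7, 8}`, `pa(5) = {6}`,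
`pa(6) = pa(7) = {8}`, `pa(8) = ∅`. -/
def exPa : Fin 8 → Finset (Fin 8) :=
  ![{4, 5}, {4, 5}, {6, 7}, {6, 7}, {5}, {7}, {7}, ∅]

/-- The cliques `{4, 7, 8}, {3, 7, 8}, {6, 8}, {2, 5, 6}, {1, 5, 6}`. -/
def exCliques : Fin 5 → Finset (Fin 8) :=
  ![{3, 6, 7}, {2, 6, 7}, {5, 7}, {1, 4, 5}, {0, 4, 5}]

theorem exGraph_adj_iff (a b : Fin 8) :
    exGraph.Adj a b ↔ a ≠ b ∧ ∃ j, a ∈ exCliques j ∧ b ∈ exCliques j := by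
  unfold exGraph
  rw [SimpleGraph.fromEdgeSet_adj, Finset.mem_coe]
  revert a b
  decide

theorem exCliques_cover (s : Finset (Fin 8)) (hs : exGraph.IsClique (s : Set (Fin 8))) :
    ∃ j, s ⊆ exCliques j := by
  rcases s.eq_empty_or_nonempty with rfl | hne
  · exact ⟨0, by simp⟩
  · have key : ∀ v : Fin 8, ∃ j, ∀ w, v ≤ w →
        (w = v ∨ ∃ k, w ∈ exCliques k ∧ v ∈ exCliques k) → w ∈ exCliques j := by decide
    obtain ⟨j, hj⟩ := key (s.min' hne)
    refine ⟨j, fun w hw => hj w (s.min'_le w hw) ?_⟩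
    by_cases h : w = s.min' hne
    · exact Or.inl h
    · exact Or.inr ((exGraph_adj_iff _ _).1 (hs hw (s.min'_mem hne) h)).2

theorem exCliques_isClique (j : Fin 5) : exGraph.IsClique (exCliques j : Set (Fin 8)) :=
  fun a ha b hb hab => (exGraph_adj_iff a b).2 ⟨hab, j, ha, hb⟩

theorem exCliques_eq_of_subset : ∀ j k, exCliques j ⊆ exCliques k → j = k := by decide

theorem exCliques_isMaxClique_iff (s : Finset (Fin 8)) :
    IsMaxClique exGraph s ↔ ∃ j, exCliques j = s := by
  constructor
  · intro h
    obtain ⟨j, hj⟩ := exCliques_cover s h.prop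
    exact ⟨j, (h.eq_of_le (exCliques_isClique j) hj).symm⟩
  · rintro ⟨j, rfl⟩
    refine ⟨exCliques_isClique j, fun t ht hjt => ?_⟩
    obtain ⟨k, hk⟩ := exCliques_cover t ht
    have hjk : j = k := exCliques_eq_of_subset j k (Finset.Subset.trans hjt hk)
    subst hjk
    exact hk

/-- The perfect order `({4,7,8}, {3,7,8}, {6,8}, {2,5,6}, {1,5,6})`; its separators are
`S₂ = {7,8}, S₃ = {8}, S₄ = {6}, S₅ = {5,6}`. -/
def exOrder : PerfectOrder exGraph 4 where
  C := exCliques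
  injective := fun j k h => exCliques_eq_of_subset j k (by rw [h])
  isMaxClique_iff := exCliques_isMaxClique_iff
  running := by decide

/-- The parameters `α₁, …, α₅`. -/
def exAlpha (θ : ShapeParam exGraph) : Fin 5 → ℝ := fun j => θ.1 (exOrder.clique j)

/-- The parameters `β₂, …, β₅`. -/
def exBeta (θ : ShapeParam exGraph) : Fin 4 → ℝ := fun i => θ.2 (exOrder.sep i)

/-- `α₄ + α₅ - β₄ - β₅`. -/
def exEta (θ : ShapeParam exGraph) : ℝ :=
  exAlpha θ 3 + exAlpha θ 4 - exBeta θ 2 - exBeta θ 3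

/-- The exponents `λ₁, …, λ₈`. -/
def exLam (θ : ShapeParam exGraph) : Fin 8 → ℝ :=
  ![exAlpha θ 4,
    exAlpha θ 3,
    exAlpha θ 1,
    exAlpha θ 0,
    exAlpha θ 3 + exAlpha θ 4 - exBeta θ 3,
    exAlpha θ 2,
    exAlpha θ 0 + exAlpha θ 1 - exBeta θ 0,
    exAlpha θ 0 + exAlpha θ 1 + exAlpha θ 2 - exBeta θ 0 - exBeta θ 1]

end Example

/-! Label the vertices so that each precedes its parents, and attach to the vertex j the entries
Σ_jj and Σ_{j,pa(j)}. In these coordinates everything is triangular. The cone Q_G is the region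
where all conditional variances Σ_{jj|pa(j)} are positive (`mem_coneQ_iff`). If L is the unit
triangular matrix of the regressions of U on parents and D the diagonal matrix of its conditional
variances, then U⁻¹ = LᵀD⁻¹L, so tr(ΣU⁻¹) is a sum of one term per vertex, and the term of j
involves Σ only on {j} ∪ pa(j) (`expTrace_eq`). Integrating out the vertices in increasing order,
each step is a Gamma integral times a Gaussian integral, with a value independent of the entries
that remain (`lintegral_vertexDensity`). Hence the Riesz integral is a constant times ∏
U_{jj|pa(j)}^{λ_j} if all λ_j > pa_j/2, and infinite otherwise.

In the example every clique or separator determinant is a product of conditional variances of the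
DAG, except that some end in Σ_66, which is not one of them because 8 is a parent of 6. Its total
exponent in H_G is η = α₄ + α₅ - β₄ - β₅. When η = 0, H_G(α,β) is the product of the
Σ_{jj|pa(j)}^{λ_j}, so the integral is proportional to H_G(α,β,U) and (A1), (A2) follow.

This is a single linear equation on nine parameters plus open conditions, so 𝓐 has dimension at
least 8. In contrast, A_P imposes one equation per separator other than S₂. All perfect orders have
the same separators (`sep_surjective`), so each equation determines one β(S) from α; only the five α
and one β stay free. A countable union of such sets has dimension 6 < 8. -/

set_option linter.unusedSectionVars false

/-! ### Schur complements and conditional variances. -/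

section Schur

variable {V : Type*} [DecidableEq V]

/-- `insert j A` as the disjoint union of `A` and a point. -/
def insertEquivSum {j : V} {A : Finset V} (hj : j ∉ A) :
    A ⊕ PUnit.{1} ≃ (insert j A : Finset V) :=
  ((Finset.subtypeInsertEquivOption hj).trans (Equiv.optionEquivSumPUnit A)).symm

variable [Fintype V]

theorem principal_apply (M : Matrix V V ℝ) (A : Finset V) (a b : A) :
    principal M A a b = M a b := rfl

theorem principal_insert_submatrix (M : Matrix V V ℝ) {j : V} {A : Finset V} (hj : j ∉ A) :
    (principal M (insert j A)).submatrix (insertEquivSum hj) (insertEquivSum hj) =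
      Matrix.fromBlocks (principal M A) (Matrix.of fun (a : A) (_ : PUnit.{1}) => M a j)
        (Matrix.of fun (_ : PUnit.{1}) (a : A) => M j a)
        (Matrix.of fun (_ _ : PUnit.{1}) => M j j) := by
  ext x y
  rcases x with a | u <;> rcases y with b | v <;> rfl

theorem schur_apply (M : Matrix V V ℝ) (j : V) (A : Finset V) (u v : PUnit.{1}) :
    ((Matrix.of fun (_ _ : PUnit.{1}) => M j j) -
      (Matrix.of fun (_ : PUnit.{1}) (a : A) => M j a) * (principal M A)⁻¹ *
        (Matrix.of fun (a : A) (_ : PUnit.{1}) => M a j)) u v = condVar M j A := by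
  rw [Matrix.mul_assoc]
  rfl

theorem det_principal_insert (M : Matrix V V ℝ) {j : V} {A : Finset V} (hj : j ∉ A)
    (hA : (principal M A).det ≠ 0) :
    (principal M (insert j A)).det = condVar M j A * (principal M A).det := by
  have := Matrix.invertibleOfIsUnitDet _ (isUnit_iff_ne_zero.2 hA)
  rw [← Matrix.det_submatrix_equiv_self (insertEquivSum hj), principal_insert_submatrix M hj,
    Matrix.det_fromBlocks₁₁, mul_comm, Matrix.invOf_eq_nonsing_inv, Matrix.det_unique,
    schur_apply]

theorem principal_posDef_mono {M : Matrix V V ℝ} {A B : Finset V} (h : A ⊆ B)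
    (hB : (principal M B).PosDef) : (principal M A).PosDef :=
  hB.submatrix (e := fun a : A => (⟨a, h a.2⟩ : B))
    fun _ _ hab => Subtype.ext (congrArg (fun x : B => (x : V)) hab)

theorem principal_posDef_empty (M : Matrix V V ℝ) : (principal M ∅).PosDef := by
  convert Matrix.PosDef.one (n := (∅ : Finset V)) (R := ℝ)
  ext a
  exact absurd a.2 (Finset.notMem_empty _)

/-- The conditional variance is the Schur complement of the block A, so positivity can be tested one
vertex at a time. -/
theorem principal_posDef_insert_iff {M : Matrix V V ℝ} (hM : M.IsSymm) {j : V} {A : Finset V}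
    (hj : j ∉ A) :
    (principal M (insert j A)).PosDef ↔ (principal M A).PosDef ∧ 0 < condVar M j A := by
  constructor
  · intro h
    have hA := principal_posDef_mono (Finset.subset_insert j A) h
    refine ⟨hA, ?_⟩
    have h1 := h.det_pos
    rw [det_principal_insert M hj hA.det_pos.ne'] at h1
    exact pos_of_mul_pos_left h1 hA.det_pos.le
  · rintro ⟨hA, hc⟩
    have := Matrix.invertibleOfIsUnitDet _ (isUnit_iff_ne_zero.2 hA.det_pos.ne')
    -- The Schur criterion yields semidefiniteness; the nonzero determinant then upgrades it.
    have hpsd : (principal M (insert j A)).PosSemidef := by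
      rw [← Matrix.posSemidef_submatrix_equiv (insertEquivSum hj), principal_insert_submatrix M hj]
      have hsymm : (Matrix.of fun (_ : PUnit.{1}) (a : A) => M j a) =
          (Matrix.of fun (a : A) (_ : PUnit.{1}) => M a j)ᴴ := by
        ext u a
        exact (hM.apply _ _).symm
      rw [hsymm, hA.fromBlocks₁₁, ← hsymm]
      have hdiag := Matrix.PosSemidef.diagonal (n := PUnit.{1}) (d := fun _ => condVar M j A)
        (fun _ => hc.le)
      refine (congrArg Matrix.PosSemidef (Matrix.ext fun u v => ?_)).mpr hdiag
      rw [schur_apply, Matrix.diagonal_apply, if_pos rfl]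
    rw [hpsd.posDef_iff_det_ne_zero, det_principal_insert M hj hA.det_pos.ne']
    exact (mul_pos hc hA.det_pos).ne'

theorem condVar_congr {M N : Matrix V V ℝ} {j : V} {A : Finset V}
    (h : ∀ a ∈ insert j A, ∀ b ∈ insert j A, M a b = N a b) : condVar M j A = condVar N j A := by
  have hj := Finset.mem_insert_self j A
  have hA : ∀ a : A, (a : V) ∈ insert j A := fun a => Finset.mem_insert_of_mem a.2
  have h1 : principal M A = principal N A := by
    ext a b
    exact h _ (hA a) _ (hA b)
  have h2 : (fun a : A => M j a) = fun a : A => N j a := funext fun a => h _ hj _ (hA a)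
  have h3 : (fun a : A => M a j) = fun a : A => N a j := funext fun a => h _ (hA a) _ hj
  unfold condVar
  rw [h1, h2, h3, h _ hj _ hj]

end Schur

/-! ### Coordinates of incomplete matrices and the cone Q_G. -/

section Cone

variable {V : Type*} [Fintype V] [DecidableEq V] {G : SimpleGraph V}

/-- The coordinate of a diagonal entry or of an edge. -/
def edgeIdx {i j : V} (h : i = j ∨ G.Adj i j) : EdgeIdx G :=
  ⟨s(i, j), h.imp (fun h => by simp [h]) (fun h => by simpa using h)⟩

theorem toMatrix_apply (Γ : IncompleteMatrix G) {i j : V} (h : i = j ∨ G.Adj i j) :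
    Γ.toMatrix i j = Γ (edgeIdx h) := by
  unfold IncompleteMatrix.toMatrix edgeIdx
  rw [Matrix.of_apply, dif_pos]

theorem toMatrix_apply_eq_zero (Γ : IncompleteMatrix G) {i j : V} (h : ¬ (i = j ∨ G.Adj i j)) :
    Γ.toMatrix i j = 0 := by
  unfold IncompleteMatrix.toMatrix
  rw [Matrix.of_apply, dif_neg]
  simpa using h

theorem edgeIdx_swap {i j : V} (h : i = j ∨ G.Adj i j) (h' : j = i ∨ G.Adj j i) :
    edgeIdx h = edgeIdx h' :=
  Subtype.ext Sym2.eq_swap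

theorem toMatrix_isSymm (Γ : IncompleteMatrix G) : Γ.toMatrix.IsSymm := by
  ext i j
  rw [Matrix.transpose_apply]
  by_cases h : i = j ∨ G.Adj i j
  · have h' : j = i ∨ G.Adj j i := h.imp Eq.symm SimpleGraph.Adj.symm
    rw [toMatrix_apply Γ h, toMatrix_apply Γ h', edgeIdx_swap]
  · rw [toMatrix_apply_eq_zero Γ h, toMatrix_apply_eq_zero]
    exact fun h' => h (h'.imp Eq.symm SimpleGraph.Adj.symm)

theorem exists_isMaxClique_of_isClique {A : Finset V} (hA : G.IsClique (A : Set V)) :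
    ∃ C, IsMaxClique G C ∧ A ⊆ C := by
  obtain ⟨C, hAC, hC⟩ := (Set.toFinite {s : Finset V | G.IsClique (s : Set V)}).exists_le_maximal hA
  exact ⟨C, hC, hAC⟩

theorem principal_posDef_of_mem_coneQ {Γ : IncompleteMatrix G} (hΓ : Γ ∈ coneQ G) {A : Finset V}
    (hA : G.IsClique (A : Set V)) : (principal Γ.toMatrix A).PosDef := by
  obtain ⟨C, hC, hAC⟩ := exists_isMaxClique_of_isClique hA
  exact principal_posDef_mono hAC (hΓ C hC)

end Cone

/-! ### Perfect DAGs and the description of Q_G by conditional variances. -/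

/-- `pa` is a perfect DAG version of `G` in which every vertex precedes its parents. -/
structure IsOrderedPerfectDAG {n : ℕ} (pa : Fin n → Finset (Fin n)) (G : SimpleGraph (Fin n)) :
    Prop where
  adj_iff : ∀ v w, G.Adj v w ↔ v ∈ pa w ∨ w ∈ pa v
  perfect : IsPerfectDAG pa
  lt : ∀ v, ∀ p ∈ pa v, v < p

namespace IsOrderedPerfectDAG

variable {n : ℕ} {pa : Fin n → Finset (Fin n)} {G : SimpleGraph (Fin n)}

theorem notMem (h : IsOrderedPerfectDAG pa G) (j : Fin n) : j ∉ pa j :=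
  fun hj => lt_irrefl _ (h.lt j j hj)

theorem adj (h : IsOrderedPerfectDAG pa G) {j p : Fin n} (hp : p ∈ pa j) : G.Adj j p :=
  (h.adj_iff _ _).2 (Or.inr hp)

theorem eq_or_adj (h : IsOrderedPerfectDAG pa G) {j a b : Fin n} (ha : a ∈ insert j (pa j))
    (hb : b ∈ insert j (pa j)) : a = b ∨ G.Adj a b := by
  rw [or_iff_not_imp_left]
  intro hab
  rcases Finset.mem_insert.1 ha with rfl | ha <;> rcases Finset.mem_insert.1 hb with rfl | hb
  · exact absurd rfl hab
  · exact h.adj hb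
  · exact (h.adj ha).symm
  · exact (h.adj_iff _ _).2 (h.perfect _ _ ha _ hb hab)

theorem isClique_insert (h : IsOrderedPerfectDAG pa G) (j : Fin n) :
    G.IsClique ((insert j (pa j) : Finset (Fin n)) : Set (Fin n)) := fun _ ha _ hb hab =>
  (h.eq_or_adj (Finset.mem_coe.1 ha) (Finset.mem_coe.1 hb)).resolve_left hab

theorem isClique_pa (h : IsOrderedPerfectDAG pa G) (j : Fin n) :
    G.IsClique (pa j : Set (Fin n)) :=
  (h.isClique_insert j).subset (Finset.coe_subset.2 (Finset.subset_insert _ _))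

theorem mem_pa_of_adj (h : IsOrderedPerfectDAG pa G) {j k : Fin n} (hjk : G.Adj j k)
    (hlt : j < k) : k ∈ pa j :=
  ((h.adj_iff _ _).1 hjk).resolve_left fun hj => lt_asymm hlt (h.lt _ _ hj)

/-- The other members of a clique are larger than its minimum and adjacent to it, hence are its
parents. -/
theorem subset_insert_min' (h : IsOrderedPerfectDAG pa G) {C : Finset (Fin n)}
    (hC : G.IsClique (C : Set (Fin n))) (hne : C.Nonempty) :
    C ⊆ insert (C.min' hne) (pa (C.min' hne)) := by
  intro k hk
  rcases (C.min'_le k hk).eq_or_lt with heq | hlt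
  · exact Finset.mem_insert.2 (Or.inl heq.symm)
  · exact Finset.mem_insert_of_mem
      (h.mem_pa_of_adj (hC (C.min'_mem hne) hk hlt.ne) hlt)

/-- The parents of `j` span a positive definite block as soon as the conditional variances of the
later vertices are positive. -/
theorem principal_pa_posDef (h : IsOrderedPerfectDAG pa G) {M : Matrix (Fin n) (Fin n) ℝ}
    (hM : M.IsSymm) (j : Fin n) (hpos : ∀ k, j < k → 0 < condVar M k (pa k)) :
    (principal M (pa j)).PosDef := by
  induction j using WellFoundedGT.induction with
  | ind j ih =>
    rcases (pa j).eq_empty_or_nonempty with he | hne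
    · rw [he]
      exact principal_posDef_empty M
    · have hlt : j < (pa j).min' hne := h.lt j _ (Finset.min'_mem _ hne)
      refine principal_posDef_mono (h.subset_insert_min' (h.isClique_pa j) hne) ?_
      exact (principal_posDef_insert_iff hM (h.notMem _)).2
        ⟨ih _ hlt fun k hk => hpos k (hlt.trans hk), hpos _ hlt⟩

/-- Each {j} ∪ pa(j) is complete, and every clique lies in one of these sets, so the clique
conditions reduce to one inequality per vertex. -/
theorem mem_coneQ_iff (h : IsOrderedPerfectDAG pa G) (Γ : IncompleteMatrix G) :
    Γ ∈ coneQ G ↔ ∀ j, 0 < condVar Γ.toMatrix j (pa j) := by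
  have hs := toMatrix_isSymm Γ
  constructor
  · intro hΓ j
    exact ((principal_posDef_insert_iff hs (h.notMem j)).1
      (principal_posDef_of_mem_coneQ hΓ (h.isClique_insert j))).2
  · intro hpos C hC
    rcases C.eq_empty_or_nonempty with rfl | hne
    · exact principal_posDef_empty _
    · exact principal_posDef_mono (h.subset_insert_min' hC.prop hne)
        ((principal_posDef_insert_iff hs (h.notMem _)).2
          ⟨h.principal_pa_posDef hs _ fun k _ => hpos k, hpos _⟩)

end IsOrderedPerfectDAG

/-! ### Uniqueness of the positive definite completion. -/

section Uniqueness

open scoped MatrixOrder Matrix.Norms.L2Operator in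
theorem posDef_exists_eq_transpose_mul_self {ι : Type*} [Fintype ι] [DecidableEq ι]
    {A : Matrix ι ι ℝ} (hA : A.PosDef) : ∃ R : Matrix ι ι ℝ, IsUnit R ∧ A = Rᵀ * R := by
  obtain ⟨R, hR, h⟩ := CStarAlgebra.isStrictlyPositive_iff_eq_star_mul_self.1
    (Matrix.isStrictlyPositive_iff_posDef.2 hA)
  exact ⟨R, hR, by rw [h, Matrix.star_eq_conjTranspose, Matrix.conjTranspose_eq_transpose_of_trivial]⟩

/-- With A = RᵀR and B = SᵀS the trace is the squared Frobenius norm of R D Sᵀ. -/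
theorem eq_zero_of_trace_mul_posDef {ι : Type*} [Fintype ι] [DecidableEq ι]
    {A B D : Matrix ι ι ℝ} (hA : A.PosDef) (hB : B.PosDef) (hD : D.IsSymm)
    (h : (D * A * D * B).trace = 0) : D = 0 := by
  obtain ⟨R, hR, rfl⟩ := posDef_exists_eq_transpose_mul_self hA
  obtain ⟨S, hS, rfl⟩ := posDef_exists_eq_transpose_mul_self hB
  have hX : ((R * D * Sᵀ)ᵀ * (R * D * Sᵀ)).trace = 0 := by
    rw [← h, Matrix.transpose_mul, Matrix.transpose_mul, Matrix.transpose_transpose, hD.eq]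
    rw [show S * (D * Rᵀ) * (R * D * Sᵀ) = S * (D * (Rᵀ * R) * D * Sᵀ) by
      simp only [Matrix.mul_assoc], Matrix.trace_mul_comm]
    simp only [Matrix.mul_assoc]
  rw [← Matrix.conjTranspose_eq_transpose_of_trivial,
    Matrix.trace_conjTranspose_mul_self_eq_zero_iff] at hX
  have hS' : IsUnit Sᵀ := (Matrix.isUnit_transpose S).2 hS
  exact hR.mul_right_eq_zero.1 (hS'.mul_left_eq_zero.1 hX)

variable {V : Type*} [Fintype V] [DecidableEq V] {G : SimpleGraph V}

theorem IsCompletion.isSymm {Γ : IncompleteMatrix G} {M : Matrix V V ℝ}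
    (hM : IsCompletion Γ M) : M.IsSymm := by
  have := hM.1.isHermitian
  rwa [Matrix.IsHermitian, Matrix.conjTranspose_eq_transpose_of_trivial] at this

/-- M - N vanishes on the edges and diagonal, M⁻¹ - N⁻¹ everywhere else, so their product has trace
0. Since M⁻¹ - N⁻¹ = -M⁻¹(M - N)N⁻¹, that trace is a definite quadratic form in M - N. -/
theorem IsCompletion.unique {Γ : IncompleteMatrix G} {M N : Matrix V V ℝ}
    (hM : IsCompletion Γ M) (hN : IsCompletion Γ N) : M = N := by
  have h0 : ((M - N) * (M⁻¹ - N⁻¹)).trace = 0 := by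
    refine Finset.sum_eq_zero fun i _ => ?_
    rw [Matrix.diag_apply, Matrix.mul_apply]
    refine Finset.sum_eq_zero fun j _ => ?_
    by_cases hij : i = j ∨ G.Adj i j
    · rw [Matrix.sub_apply, hM.2.1 i j hij, hN.2.1 i j hij, sub_self, zero_mul]
    · push Not at hij
      have hji : ¬ G.Adj j i := fun h => hij.2 h.symm
      rw [Matrix.sub_apply M⁻¹, hM.2.2 j i hij.1.symm hji, hN.2.2 j i hij.1.symm hji, sub_self,
        mul_zero]
  have hMu := (Matrix.isUnit_iff_isUnit_det _).1 hM.1.isUnit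
  have hNu := (Matrix.isUnit_iff_isUnit_det _).1 hN.1.isUnit
  have h1 : M⁻¹ * (M - N) * N⁻¹ = -(M⁻¹ - N⁻¹) := by
    rw [Matrix.mul_sub, Matrix.nonsing_inv_mul _ hMu, Matrix.sub_mul, Matrix.one_mul,
      Matrix.mul_assoc, Matrix.mul_nonsing_inv _ hNu, Matrix.mul_one, neg_sub]
  refine sub_eq_zero.1 (eq_zero_of_trace_mul_posDef hM.1.inv hN.1.inv
    (hM.isSymm.sub hN.isSymm) ?_)
  rw [Matrix.mul_assoc, Matrix.mul_assoc, ← Matrix.mul_assoc M⁻¹, h1, Matrix.mul_neg,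
    Matrix.trace_neg, h0, neg_zero]

end Uniqueness

/-! ### The inverse of the completion and the splitting of the trace. -/

noncomputable section

/-- The regression coefficients `(M_A)⁻¹ M_{A,j}`. -/
def regCoef {V : Type*} [Fintype V] [DecidableEq V] (M : Matrix V V ℝ) (j : V) (A : Finset V) :
    A → ℝ :=
  (principal M A)⁻¹ *ᵥ fun a : A => M a j

/-- The quadratic form `M_{jj} - 2 c · M_{A,j} + c · M_A c`. -/
def residualForm {V : Type*} [Fintype V] [DecidableEq V] (M : Matrix V V ℝ) (j : V) (A : Finset V)
    (c : A → ℝ) : ℝ :=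
  M j j - 2 * (c ⬝ᵥ fun a : A => M a j) + c ⬝ᵥ (principal M A *ᵥ c)

variable {n : ℕ}

/-- The unit triangular matrix with rows `e_j - c_j`. -/
def unitTri (pa : Fin n → Finset (Fin n)) (c : ∀ j, pa j → ℝ) : Matrix (Fin n) (Fin n) ℝ :=
  Matrix.of fun j k => (if j = k then 1 else 0) - if h : k ∈ pa j then c j ⟨k, h⟩ else 0

theorem unitTri_mul_apply (pa : Fin n → Finset (Fin n)) (c : ∀ j, pa j → ℝ)
    (N : Matrix (Fin n) (Fin n) ℝ) (j k : Fin n) :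
    (unitTri pa c * N) j k = N j k - c j ⬝ᵥ fun p : pa j => N p k := by
  rw [Matrix.mul_apply]
  simp only [unitTri, Matrix.of_apply, sub_mul, Finset.sum_sub_distrib, ite_mul, one_mul, zero_mul,
    Finset.sum_ite_eq, Finset.mem_univ, if_true]
  congr 1
  rw [← Finset.sum_subset (Finset.subset_univ (pa j)), ← Finset.sum_coe_sort]
  · exact Finset.sum_congr rfl fun p _ => by rw [dif_pos p.2]
  · intro p _ hp
    rw [dif_neg hp, zero_mul]

theorem unitTri_apply_eq_zero {pa : Fin n → Finset (Fin n)} (c : ∀ j, pa j → ℝ) {j k : Fin n}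
    (h : k ∉ insert j (pa j)) : unitTri pa c j k = 0 := by
  rw [Finset.mem_insert, not_or] at h
  simp [unitTri, h.2, Ne.symm h.1]

theorem unitTri_mul_mul_transpose_apply (pa : Fin n → Finset (Fin n)) (c : ∀ j, pa j → ℝ)
    {N : Matrix (Fin n) (Fin n) ℝ} (hN : N.IsSymm) (j : Fin n) :
    (unitTri pa c * N * (unitTri pa c)ᵀ) j j = residualForm N j (pa j) (c j) := by
  have h1 : (unitTri pa c * N * (unitTri pa c)ᵀ) j j =
      (unitTri pa c * (unitTri pa c * N)ᵀ) j j := by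
    simp only [Matrix.mul_apply, Matrix.transpose_apply]
    exact Finset.sum_congr rfl fun k _ => mul_comm _ _
  have h2 : (fun p : pa j => (unitTri pa c * N) j p) =
      (fun p : pa j => N p j) - principal N (pa j) *ᵥ c j := by
    ext p
    rw [unitTri_mul_apply, Pi.sub_apply, hN.apply, Matrix.mulVec, dotProduct_comm]
    congr 2
    ext q
    exact hN.apply _ _
  rw [h1, unitTri_mul_apply]
  simp only [Matrix.transpose_apply]
  rw [h2, unitTri_mul_apply, dotProduct_sub, residualForm]
  ring

namespace IsOrderedPerfectDAG

variable {pa : Fin n → Finset (Fin n)} {G : SimpleGraph (Fin n)}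

theorem unitTri_isUpper (h : IsOrderedPerfectDAG pa G) (c : ∀ j, pa j → ℝ) :
    (unitTri pa c).BlockTriangular id := by
  intro j k hkj
  refine unitTri_apply_eq_zero c fun hk => ?_
  rcases Finset.mem_insert.1 hk with rfl | hk
  · exact lt_irrefl _ hkj
  · exact lt_asymm hkj (h.lt _ _ hk)

theorem unitTri_diag (h : IsOrderedPerfectDAG pa G) (c : ∀ j, pa j → ℝ) (j : Fin n) :
    unitTri pa c j j = 1 := by
  simp [unitTri, h.notMem j]

theorem unitTri_det (h : IsOrderedPerfectDAG pa G) (c : ∀ j, pa j → ℝ) :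
    (unitTri pa c).det = 1 := by
  rw [Matrix.det_of_isUpperTriangular (h.unitTri_isUpper c)]
  exact Finset.prod_eq_one fun j _ => h.unitTri_diag c j

theorem unitTri_inv_isUpper (h : IsOrderedPerfectDAG pa G) (c : ∀ j, pa j → ℝ) :
    (unitTri pa c)⁻¹.BlockTriangular id := by
  have hu : IsUnit (unitTri pa c).det := by rw [h.unitTri_det c]; exact isUnit_one
  have := Matrix.invertibleOfIsUnitDet _ hu
  exact Matrix.blockTriangular_inv_of_blockTriangular (h.unitTri_isUpper c)

theorem unitTri_inv_diag (h : IsOrderedPerfectDAG pa G) (c : ∀ j, pa j → ℝ) (j : Fin n) :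
    (unitTri pa c)⁻¹ j j = 1 := by
  have hu : IsUnit (unitTri pa c).det := by rw [h.unitTri_det c]; exact isUnit_one
  have h1 := congrFun (congrFun (Matrix.mul_nonsing_inv _ hu) j) j
  rw [Matrix.mul_apply, Finset.sum_eq_single j, h.unitTri_diag c, one_mul,
    Matrix.one_apply_eq] at h1
  · exact h1
  · intro k _ hkj
    rcases hkj.lt_or_gt with hlt | hlt
    · rw [h.unitTri_isUpper c hlt, zero_mul]
    · rw [h.unitTri_inv_isUpper c hlt, mul_zero]
  · exact fun hj => absurd (Finset.mem_univ j) hj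

/-- The inverse of the completion, in terms of conditional variances and regression
coefficients. -/
def _root_.precisionOf (pa : Fin n → Finset (Fin n)) (M : Matrix (Fin n) (Fin n) ℝ) :
    Matrix (Fin n) (Fin n) ℝ :=
  (unitTri pa fun j => regCoef M j (pa j))ᵀ *
    Matrix.diagonal (fun j => (condVar M j (pa j))⁻¹) * unitTri pa fun j => regCoef M j (pa j)

theorem precisionOf_posDef (h : IsOrderedPerfectDAG pa G) {M : Matrix (Fin n) (Fin n) ℝ}
    (hpos : ∀ j, 0 < condVar M j (pa j)) : (precisionOf pa M).PosDef := by
  have hu : IsUnit (unitTri pa fun j => regCoef M j (pa j)) := by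
    rw [Matrix.isUnit_iff_isUnit_det, h.unitTri_det]
    exact isUnit_one
  have := (Matrix.IsUnit.posDef_star_left_conjugate_iff hu
    (x := Matrix.diagonal (fun j => (condVar M j (pa j))⁻¹))).2
    (Matrix.PosDef.diagonal fun j => inv_pos.2 (hpos j))
  rwa [Matrix.star_eq_conjTranspose, Matrix.conjTranspose_eq_transpose_of_trivial] at this

/-- The contribution of the vertex j to LᵀD⁻¹L is supported on the complete set {j} ∪ pa(j). -/
theorem precisionOf_apply_eq_zero (h : IsOrderedPerfectDAG pa G) (M : Matrix (Fin n) (Fin n) ℝ)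
    {a b : Fin n} (hab : ¬ (a = b ∨ G.Adj a b)) : precisionOf pa M a b = 0 := by
  rw [precisionOf, Matrix.mul_apply]
  refine Finset.sum_eq_zero fun j _ => ?_
  rw [Matrix.mul_diagonal, Matrix.transpose_apply]
  by_cases ha : a ∈ insert j (pa j)
  · have hb : b ∉ insert j (pa j) := fun hb => hab (h.eq_or_adj ha hb)
    rw [unitTri_apply_eq_zero _ hb, mul_zero]
  · rw [unitTri_apply_eq_zero _ ha, zero_mul, zero_mul]

/-- The inverse N satisfies LN = D(L⁻¹)ᵀ with a lower triangular right-hand side. Read along row j,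
from the diagonal on, these are the regression equations that M satisfies on {j} ∪ pa(j), so N and M
agree there by induction from the last vertex down. -/
theorem precisionOf_inv_apply (h : IsOrderedPerfectDAG pa G) {M : Matrix (Fin n) (Fin n) ℝ}
    (hM : M.IsSymm) (hpos : ∀ j, 0 < condVar M j (pa j)) (j : Fin n) :
    ∀ k ∈ insert j (pa j), (precisionOf pa M)⁻¹ j k = M j k := by
  set c : ∀ j, pa j → ℝ := fun j => regCoef M j (pa j) with hc
  set N := (precisionOf pa M)⁻¹ with hN
  have hNs : N.IsSymm := by
    have := (h.precisionOf_posDef hpos).inv.isHermitian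
    rwa [Matrix.IsHermitian, Matrix.conjTranspose_eq_transpose_of_trivial] at this
  have hu : IsUnit (unitTri pa c).det := by rw [h.unitTri_det c]; exact isUnit_one
  have hLN : unitTri pa c * N =
      Matrix.diagonal (fun j => condVar M j (pa j)) * ((unitTri pa c)⁻¹)ᵀ := by
    have hD : (Matrix.diagonal fun j => (condVar M j (pa j))⁻¹)⁻¹ =
        Matrix.diagonal (fun j => condVar M j (pa j)) := by
      refine Matrix.inv_eq_left_inv ?_
      rw [Matrix.diagonal_mul_diagonal, ← Matrix.diagonal_one]
      congr 1
      ext j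
      exact mul_inv_cancel₀ (hpos j).ne'
    rw [hN, precisionOf, Matrix.mul_inv_rev, Matrix.mul_inv_rev, ← Matrix.mul_assoc,
      Matrix.mul_nonsing_inv _ hu, Matrix.one_mul, hD, Matrix.transpose_nonsing_inv]
  have hentry : ∀ j k, N j k =
      condVar M j (pa j) * (unitTri pa c)⁻¹ k j + c j ⬝ᵥ fun p : pa j => N p k := by
    intro j k
    have h1 := congrFun (congrFun hLN j) k
    rw [unitTri_mul_apply, Matrix.diagonal_mul, Matrix.transpose_apply] at h1
    linarith
  induction j using WellFoundedGT.induction with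
  | ind j ih =>
    have hoff : ∀ k ∈ pa j, N j k = M j k := by
      intro k hk
      -- Two distinct parents of j are adjacent, and the larger is a parent of the smaller; the
      -- induction hypothesis at the smaller one gives the entry.
      have h1 : (fun p : pa j => N p k) = fun p : pa j => principal M (pa j) ⟨k, hk⟩ p := by
        ext p
        have hpk := h.eq_or_adj (Finset.mem_insert_of_mem p.2) (Finset.mem_insert_of_mem hk)
        rw [principal_apply]
        rcases lt_trichotomy (p : Fin n) k with hlt | heq | hlt
        · rw [ih p (h.lt _ _ p.2) k
            (Finset.mem_insert_of_mem (h.mem_pa_of_adj (hpk.resolve_left hlt.ne) hlt)), hM.apply]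
        · rw [heq, ih k (h.lt _ _ hk) k (Finset.mem_insert_self _ _)]
        · rw [← hNs.apply, ih k (h.lt _ _ hk) p (Finset.mem_insert_of_mem
            (h.mem_pa_of_adj (hpk.resolve_left hlt.ne').symm hlt))]
      have hP := h.principal_pa_posDef hM j fun k _ => hpos k
      have hPu := (Matrix.isUnit_iff_isUnit_det _).1 hP.isUnit
      rw [hentry, h.unitTri_inv_isUpper c (h.lt _ _ hk), mul_zero, zero_add, h1, dotProduct_comm]
      change (principal M (pa j) *ᵥ regCoef M j (pa j)) ⟨k, hk⟩ = _
      rw [regCoef, Matrix.mulVec_mulVec, Matrix.mul_nonsing_inv _ hPu, Matrix.one_mulVec, hM.apply]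
    intro k hk
    rcases Finset.mem_insert.1 hk with rfl | hk
    · have h1 : (fun p : pa k => N p k) = fun p : pa k => M k p := by
        ext p
        rw [← hNs.apply, hoff p p.2]
      rw [hentry, h.unitTri_inv_diag c, mul_one, h1, dotProduct_comm]
      exact sub_add_cancel _ _
    · exact hoff k hk

theorem isCompletion (h : IsOrderedPerfectDAG pa G) {Γ : IncompleteMatrix G} (hΓ : Γ ∈ coneQ G) :
    IsCompletion Γ (precisionOf pa Γ.toMatrix)⁻¹ := by
  have hpos := (h.mem_coneQ_iff Γ).1 hΓ
  have hs := toMatrix_isSymm Γ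
  have hpd := h.precisionOf_posDef hpos
  have hinv := h.precisionOf_inv_apply hs hpos
  refine ⟨hpd.inv, fun i j hij => ?_, fun i j hij hadj => ?_⟩
  · rcases hij with rfl | hij
    · exact hinv i i (Finset.mem_insert_self _ _)
    · rcases (h.adj_iff _ _).1 hij with hi | hj
      · have hsymm : (precisionOf pa Γ.toMatrix)⁻¹.IsSymm := by
          have := hpd.inv.isHermitian
          rwa [Matrix.IsHermitian, Matrix.conjTranspose_eq_transpose_of_trivial] at this
        rw [← hsymm.apply, hinv j i (Finset.mem_insert_of_mem hi), hs.apply]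
      · exact hinv i j (Finset.mem_insert_of_mem hj)
  · rw [Matrix.nonsing_inv_nonsing_inv _ ((Matrix.isUnit_iff_isUnit_det _).1 hpd.isUnit)]
    exact h.precisionOf_apply_eq_zero _ (not_or.2 ⟨hij, hadj⟩)

theorem completion_eq (h : IsOrderedPerfectDAG pa G) {Γ : IncompleteMatrix G} (hΓ : Γ ∈ coneQ G) :
    completion Γ = (precisionOf pa Γ.toMatrix)⁻¹ := by
  have hex : ∃ M, IsCompletion Γ M := ⟨_, h.isCompletion hΓ⟩
  rw [completion, dif_pos hex]
  exact hex.choose_spec.unique (h.isCompletion hΓ)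

/-- The j-th diagonal entry of LΣLᵀ, with the regressions L of Υ, is the residual form of j;
dividing by the conditional variances of Υ and summing gives the trace. -/
theorem expTrace_eq (h : IsOrderedPerfectDAG pa G) {Υ Γ : IncompleteMatrix G} (hΥ : Υ ∈ coneQ G)
    (hΓ : Γ ∈ coneQ G) :
    expTrace Υ Γ = ∏ j, Real.exp (-(residualForm Γ.toMatrix j (pa j)
      (regCoef Υ.toMatrix j (pa j)) / condVar Υ.toMatrix j (pa j))) := by
  have hpd := h.precisionOf_posDef ((h.mem_coneQ_iff Υ).1 hΥ)
  have hK : (completion Υ)⁻¹ = precisionOf pa Υ.toMatrix := by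
    rw [h.completion_eq hΥ,
      Matrix.nonsing_inv_nonsing_inv _ ((Matrix.isUnit_iff_isUnit_det _).1 hpd.isUnit)]
  -- The second factor vanishes off the edges, so the completed entries of Σ do not enter the trace.
  have h1 : (completion Γ * precisionOf pa Υ.toMatrix).trace =
      (Γ.toMatrix * precisionOf pa Υ.toMatrix).trace := by
    refine Finset.sum_congr rfl fun i _ => ?_
    rw [Matrix.diag_apply, Matrix.diag_apply, Matrix.mul_apply, Matrix.mul_apply]
    refine Finset.sum_congr rfl fun j _ => ?_
    by_cases hij : i = j ∨ G.Adj i j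
    · rw [h.completion_eq hΓ, (h.isCompletion hΓ).2.1 i j hij]
    · rw [h.precisionOf_apply_eq_zero _ fun hji => hij (hji.imp Eq.symm SimpleGraph.Adj.symm),
        mul_zero, mul_zero]
  rw [expTrace, hK, h1, ← Real.exp_sum, precisionOf, ← Matrix.mul_assoc, Matrix.trace_mul_comm,
    ← Matrix.mul_assoc, ← Matrix.mul_assoc, Matrix.trace, Finset.sum_neg_distrib]
  congr 2
  refine Finset.sum_congr rfl fun j _ => ?_
  rw [Matrix.diag_apply, Matrix.mul_diagonal,
    unitTri_mul_mul_transpose_apply _ _ (toMatrix_isSymm Γ), div_eq_mul_inv]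

end IsOrderedPerfectDAG

end

/-! ### The Gamma and Gaussian integrals of a single vertex. -/

noncomputable section

/-- The (possibly infinite) integral `∫_0^∞ exp(-t/u) t^ρ dt`. -/
def gammaFactor (ρ u : ℝ) : ℝ≥0∞ :=
  ∫⁻ t in Set.Ioi (0 : ℝ), ENNReal.ofReal (Real.exp (-(t / u)) * t ^ ρ)

theorem gammaFactor_eq {ρ u : ℝ} (hρ : -1 < ρ) (hu : 0 < u) :
    gammaFactor ρ u = ENNReal.ofReal (Real.Gamma (ρ + 1) * u ^ (ρ + 1)) := by
  have hint : IntegrableOn (fun t : ℝ => Real.exp (-(t / u)) * t ^ ρ) (Set.Ioi 0) := by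
    refine (integrableOn_rpow_mul_exp_neg_mul_rpow hρ one_pos (inv_pos.2 hu)).congr_fun
      (fun t _ => ?_) measurableSet_Ioi
    simp only [Real.rpow_one]
    rw [mul_comm, neg_mul, inv_mul_eq_div]
  rw [gammaFactor, ← ofReal_integral_eq_lintegral_ofReal hint]
  · congr 1
    have h := Real.integral_rpow_mul_exp_neg_mul_Ioi (a := ρ + 1) (r := u⁻¹) (by linarith)
      (inv_pos.2 hu)
    rw [one_div, inv_inv] at h
    rw [mul_comm, ← h]
    refine setIntegral_congr_fun measurableSet_Ioi fun t _ => ?_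
    simp only [add_sub_cancel_right]
    rw [mul_comm, inv_mul_eq_div]
  · filter_upwards [ae_restrict_mem measurableSet_Ioi] with t ht
    exact mul_nonneg (Real.exp_pos _).le (Real.rpow_nonneg (le_of_lt ht) _)

/-- The divergence is at 0: on (0,1) the exponential is bounded below and t^ρ is not integrable. -/
theorem gammaFactor_eq_top {ρ u : ℝ} (hρ : ρ ≤ -1) (hu : 0 < u) : gammaFactor ρ u = ∞ := by
  have hlow : ∫⁻ t in Set.Ioo (0 : ℝ) 1, ENNReal.ofReal (t ^ ρ) = ∞ := by
    by_contra hne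
    have hmeas : AEStronglyMeasurable (fun t : ℝ => t ^ ρ) (volume.restrict (Set.Ioo 0 1)) :=
      (measurable_id.pow_const ρ).aestronglyMeasurable
    have hint : IntegrableOn (fun t : ℝ => t ^ ρ) (Set.Ioo 0 1) := by
      refine ⟨hmeas, ?_⟩
      rw [hasFiniteIntegral_iff_ofReal]
      · exact lt_top_iff_ne_top.2 hne
      · filter_upwards [ae_restrict_mem measurableSet_Ioo] with t ht
        exact Real.rpow_nonneg ht.1.le _
    rw [intervalIntegral.integrableOn_Ioo_rpow_iff one_pos] at hint
    linarith
  refine top_unique ?_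
  calc ∞ = ENNReal.ofReal (Real.exp (-(1 / u))) *
        ∫⁻ t in Set.Ioo (0 : ℝ) 1, ENNReal.ofReal (t ^ ρ) := by
        rw [hlow, ENNReal.mul_top]
        exact (ENNReal.ofReal_pos.2 (Real.exp_pos _)).ne'
    _ = ∫⁻ t in Set.Ioo (0 : ℝ) 1, ENNReal.ofReal (Real.exp (-(1 / u))) *
        ENNReal.ofReal (t ^ ρ) := by
        rw [lintegral_const_mul' _ _ ENNReal.ofReal_ne_top]
    _ ≤ ∫⁻ t in Set.Ioo (0 : ℝ) 1, ENNReal.ofReal (Real.exp (-(t / u)) * t ^ ρ) := by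
        refine setLIntegral_mono' measurableSet_Ioo fun t ht => ?_
        rw [← ENNReal.ofReal_mul (Real.exp_pos _).le]
        refine ENNReal.ofReal_le_ofReal (mul_le_mul_of_nonneg_right ?_ (Real.rpow_nonneg ht.1.le _))
        have := div_le_div_of_nonneg_right ht.2.le hu.le
        exact Real.exp_le_exp.2 (neg_le_neg this)
    _ ≤ gammaFactor ρ u := lintegral_mono_set fun t ht => ht.1

variable {ι : Type*} [Fintype ι] [DecidableEq ι]

theorem lintegral_exp_neg_sum_sq {u : ℝ} (hu : 0 < u) :
    ∫⁻ w : ι → ℝ, ENNReal.ofReal (Real.exp (-((w ⬝ᵥ w) / u))) =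
      ENNReal.ofReal ((Real.pi * u) ^ ((Fintype.card ι : ℝ) / 2)) := by
  have hprod : ∀ w : ι → ℝ, Real.exp (-((w ⬝ᵥ w) / u)) = ∏ i, Real.exp (-u⁻¹ * w i ^ 2) := by
    intro w
    rw [← Real.exp_sum, ← Finset.mul_sum, dotProduct]
    congr 1
    rw [neg_mul, inv_mul_eq_div]
    simp only [sq]
  have h1 : Integrable fun x : ℝ => Real.exp (-u⁻¹ * x ^ 2) :=
    integrable_exp_neg_mul_sq (inv_pos.2 hu)
  simp only [hprod]
  rw [← ofReal_integral_eq_lintegral_ofReal]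
  · rw [integral_fintype_prod_volume_eq_prod (fun (_ : ι) (x : ℝ) => Real.exp (-u⁻¹ * x ^ 2))]
    simp only [integral_gaussian, div_inv_eq_mul, Finset.prod_const, Finset.card_univ]
    rw [Real.sqrt_eq_rpow, ← Real.rpow_natCast, ← Real.rpow_mul (by positivity)]
    congr 2
    ring
  · exact Integrable.fintype_prod (f := fun (_ : ι) (x : ℝ) => Real.exp (-u⁻¹ * x ^ 2)) fun _ => h1
  · exact Filter.Eventually.of_forall fun w => Finset.prod_nonneg fun _ _ => (Real.exp_pos _).le

/-- Writing P⁻¹ = RᵀR, the substitution w = R(v - m) has Jacobian factor |det R|⁻¹ = √(det P). -/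
theorem lintegral_exp_neg_quadraticForm {P : Matrix ι ι ℝ} (hP : P.PosDef) (m : ι → ℝ) {u : ℝ}
    (hu : 0 < u) :
    ∫⁻ v : ι → ℝ, ENNReal.ofReal (Real.exp (-(((v - m) ⬝ᵥ (P⁻¹ *ᵥ (v - m))) / u))) =
      ENNReal.ofReal ((Real.pi * u) ^ ((Fintype.card ι : ℝ) / 2) * √P.det) := by
  obtain ⟨R, hR, hPR⟩ := posDef_exists_eq_transpose_mul_self hP.inv
  have hdet : R.det ≠ 0 := ((Matrix.isUnit_iff_isUnit_det _).1 hR).ne_zero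
  have hsq : |R.det⁻¹| = √P.det := by
    have h1 : P.det⁻¹ = R.det ^ 2 := by
      rw [← Ring.inverse_eq_inv', ← Matrix.det_nonsing_inv, hPR, Matrix.det_mul,
        Matrix.det_transpose, sq]
    rw [← inv_inv P.det, h1, ← inv_pow, Real.sqrt_sq_eq_abs]
  rw [lintegral_sub_right_eq_self
    (fun v : ι → ℝ => ENNReal.ofReal (Real.exp (-((v ⬝ᵥ (P⁻¹ *ᵥ v)) / u)))) m]
  have hform : ∀ v : ι → ℝ, v ⬝ᵥ (P⁻¹ *ᵥ v) = Matrix.toLin' R v ⬝ᵥ Matrix.toLin' R v := by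
    intro v
    rw [hPR, Matrix.toLin'_apply, ← Matrix.mulVec_mulVec, Matrix.dotProduct_mulVec,
      Matrix.vecMul_transpose]
  have hmeas : Measurable fun w : ι → ℝ => ENNReal.ofReal (Real.exp (-((w ⬝ᵥ w) / u))) := by
    unfold dotProduct
    fun_prop
  have hlin : Measurable (Matrix.toLin' R) := by
    exact (LinearMap.continuous_of_finiteDimensional _).measurable
  simp only [hform]
  rw [← lintegral_map hmeas hlin, Real.map_matrix_volume_pi_eq_smul_volume_pi hdet,
    lintegral_smul_measure, lintegral_exp_neg_sum_sq hu, hsq, smul_eq_mul,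
    ← ENNReal.ofReal_mul (Real.sqrt_nonneg _), mul_comm]

theorem completing_square {P : Matrix ι ι ℝ} (hP : P.PosDef) (c v : ι → ℝ) :
    (v - P *ᵥ c) ⬝ᵥ (P⁻¹ *ᵥ (v - P *ᵥ c)) =
      v ⬝ᵥ (P⁻¹ *ᵥ v) - 2 * (c ⬝ᵥ v) + c ⬝ᵥ (P *ᵥ c) := by
  have hPu := (Matrix.isUnit_iff_isUnit_det _).1 hP.isUnit
  have hsymm : Pᵀ = P := by
    have := hP.isHermitian
    rwa [Matrix.IsHermitian, Matrix.conjTranspose_eq_transpose_of_trivial] at this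
  have h1 : P⁻¹ *ᵥ (v - P *ᵥ c) = P⁻¹ *ᵥ v - c := by
    rw [Matrix.mulVec_sub, Matrix.mulVec_mulVec, Matrix.nonsing_inv_mul _ hPu, Matrix.one_mulVec]
  have h2 : (P *ᵥ c) ⬝ᵥ (P⁻¹ *ᵥ v) = c ⬝ᵥ v := by
    rw [dotProduct_comm, Matrix.dotProduct_mulVec, ← Matrix.mulVec_transpose, hsymm,
      Matrix.mulVec_mulVec, Matrix.mul_nonsing_inv _ hPu, Matrix.one_mulVec, dotProduct_comm]
  rw [h1, sub_dotProduct, dotProduct_sub, dotProduct_sub, h2, dotProduct_comm v c,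
    dotProduct_comm (P *ᵥ c) c]
  ring

/-- The density of one vertex given its parents. -/
def vertexDensity (ρ u σ q d : ℝ) : ℝ≥0∞ :=
  if 0 < σ then ENNReal.ofReal (Real.exp (-(q / u)) * σ ^ ρ * d ^ (-(1 / 2) : ℝ)) else 0

/-- With t = s - v·P⁻¹v the residual form is t plus a quadratic form in v - Pc, so the integral
splits into a Gamma part in t and a Gaussian part in v. The Gaussian √(det P) cancels the factor
(det P)^(-1/2): the value is free of P and c, which is what permits iteration. -/
theorem lintegral_vertexDensity {P : Matrix ι ι ℝ} (hP : P.PosDef) (c : ι → ℝ) (ρ : ℝ) {u : ℝ}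
    (hu : 0 < u) :
    ∫⁻ v : ι → ℝ, ∫⁻ s : ℝ, vertexDensity ρ u (s - v ⬝ᵥ (P⁻¹ *ᵥ v))
        (s - 2 * (c ⬝ᵥ v) + c ⬝ᵥ (P *ᵥ c)) P.det =
      gammaFactor ρ u * ENNReal.ofReal ((Real.pi * u) ^ ((Fintype.card ι : ℝ) / 2)) := by
  have hinner : ∀ v : ι → ℝ, ∫⁻ s : ℝ, vertexDensity ρ u (s - v ⬝ᵥ (P⁻¹ *ᵥ v))
        (s - 2 * (c ⬝ᵥ v) + c ⬝ᵥ (P *ᵥ c)) P.det =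
      (gammaFactor ρ u * ENNReal.ofReal (P.det ^ (-(1 / 2) : ℝ))) * ENNReal.ofReal
        (Real.exp (-(((v - P *ᵥ c) ⬝ᵥ (P⁻¹ *ᵥ (v - P *ᵥ c))) / u))) := by
    intro v
    -- Translation to the variable t; the density is 0 for t ≤ 0, which leaves the half-line.
    rw [← lintegral_add_right_eq_self _ (v ⬝ᵥ (P⁻¹ *ᵥ v)), gammaFactor,
      ← lintegral_indicator measurableSet_Ioi, mul_assoc, ← lintegral_mul_const']
    · refine lintegral_congr fun t => ?_
      rw [add_sub_cancel_right, vertexDensity]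
      by_cases ht : 0 < t
      · rw [if_pos ht, Set.indicator_of_mem (Set.mem_Ioi.2 ht), completing_square hP,
          ← ENNReal.ofReal_mul (Real.rpow_nonneg hP.det_pos.le _),
          ← ENNReal.ofReal_mul (mul_nonneg (Real.exp_pos _).le (Real.rpow_nonneg ht.le _))]
        congr 1
        rw [show t + v ⬝ᵥ (P⁻¹ *ᵥ v) - 2 * (c ⬝ᵥ v) + c ⬝ᵥ (P *ᵥ c) =
          t + (v ⬝ᵥ (P⁻¹ *ᵥ v) - 2 * (c ⬝ᵥ v) + c ⬝ᵥ (P *ᵥ c)) by ring, add_div, neg_add,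
          Real.exp_add]
        ring
      · rw [if_neg ht, Set.indicator_of_notMem (s := Set.Ioi 0) ht, zero_mul]
    · exact ENNReal.mul_ne_top ENNReal.ofReal_ne_top ENNReal.ofReal_ne_top
  have hmeas : Measurable fun v : ι → ℝ => ENNReal.ofReal
      (Real.exp (-(((v - P *ᵥ c) ⬝ᵥ (P⁻¹ *ᵥ (v - P *ᵥ c))) / u))) := by
    unfold dotProduct Matrix.mulVec dotProduct
    simp only [Pi.sub_apply]
    fun_prop
  simp only [hinner]
  rw [lintegral_const_mul _ hmeas, lintegral_exp_neg_quadraticForm hP _ hu, mul_assoc,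
    ← ENNReal.ofReal_mul (Real.rpow_nonneg hP.det_pos.le _)]
  congr 2
  rw [mul_comm ((Real.pi * u) ^ _), ← mul_assoc, Real.sqrt_eq_rpow,
    ← Real.rpow_add hP.det_pos, neg_add_cancel, Real.rpow_zero, one_mul]

end

/-! ### Iterated integration over the vertices and the generalized Riesz integral. -/

noncomputable section

section Measurability

variable {α ι : Type*} [MeasurableSpace α] [Fintype ι] [DecidableEq ι]

theorem measurable_det_of_entries {A : α → Matrix ι ι ℝ}
    (hA : ∀ i j, Measurable fun x => A x i j) : Measurable fun x => (A x).det := by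
  simp only [Matrix.det_apply']
  exact Finset.measurable_fun_sum _ fun σ _ =>
    (Finset.measurable_fun_prod _ fun i _ => hA _ _).const_mul _

theorem measurable_inv_of_entries {A : α → Matrix ι ι ℝ}
    (hA : ∀ i j, Measurable fun x => A x i j) (i j : ι) : Measurable fun x => (A x)⁻¹ i j := by
  simp only [Matrix.inv_def, Matrix.smul_apply, smul_eq_mul, Ring.inverse_eq_inv',
    Matrix.adjugate_apply]
  refine (measurable_det_of_entries hA).inv.mul (measurable_det_of_entries fun k l => ?_)
  simp only [Matrix.updateRow_apply]
  by_cases hk : k = j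
  · simp [hk]
  · simpa [hk] using hA k l

theorem measurable_condVar {A : α → Matrix ι ι ℝ} (hA : ∀ i j, Measurable fun x => A x i j)
    (j : ι) (S : Finset ι) : Measurable fun x => condVar (A x) j S := by
  have hinv := measurable_inv_of_entries (A := fun x => principal (A x) S) fun a b => hA a b
  unfold condVar Matrix.mulVec dotProduct
  exact (hA j j).sub (Finset.measurable_fun_sum _ fun a _ => (hA _ _).mul
    (Finset.measurable_fun_sum _ fun b _ => (hinv a b).mul (hA _ _)))

theorem measurable_residualForm {A : α → Matrix ι ι ℝ} (hA : ∀ i j, Measurable fun x => A x i j)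
    (j : ι) (S : Finset ι) (c : S → ℝ) : Measurable fun x => residualForm (A x) j S c := by
  unfold residualForm Matrix.mulVec dotProduct
  refine ((hA j j).sub ((Finset.measurable_fun_sum _ fun a _ => ?_).const_mul 2)).add
    (Finset.measurable_fun_sum _ fun a _ => (Finset.measurable_fun_sum _ fun b _ => ?_).const_mul _)
  · exact (hA _ _).const_mul _
  · exact (hA a b).mul_const _

theorem measurable_toMatrix_apply {G : SimpleGraph ι} (i j : ι) :
    Measurable fun Γ : IncompleteMatrix G => Γ.toMatrix i j := by
  by_cases h : i = j ∨ G.Adj i j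
  · simp only [toMatrix_apply _ h]
    exact measurable_pi_apply _
  · simp only [toMatrix_apply_eq_zero _ h]
    exact measurable_const

theorem measurable_vertexDensity (ρ u : ℝ) {σ q d : α → ℝ} (hσ : Measurable σ) (hq : Measurable q)
    (hd : Measurable d) : Measurable fun x => vertexDensity ρ u (σ x) (q x) (d x) := by
  unfold vertexDensity
  refine Measurable.ite (measurableSet_lt measurable_const hσ) ?_ measurable_const
  exact (((hq.div_const u).neg.exp.mul (hσ.pow_const ρ)).mul (hd.pow_const _)).ennreal_ofReal

end Measurability

variable {n : ℕ}

/-- The factor of the Riesz integrand that belongs to the vertex `j`. -/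
def vertexFactor {G : SimpleGraph (Fin n)} (pa : Fin n → Finset (Fin n)) (lam : Fin n → ℝ)
    (Υ : IncompleteMatrix G) (j : Fin n) (Γ : IncompleteMatrix G) : ℝ≥0∞ :=
  vertexDensity (lam j - (((pa j).card : ℝ) + 2) / 2) (condVar Υ.toMatrix j (pa j))
    (condVar Γ.toMatrix j (pa j))
    (residualForm Γ.toMatrix j (pa j) (regCoef Υ.toMatrix j (pa j)))
    (principal Γ.toMatrix (pa j)).det

/-- The integral of `vertexFactor` over the entries that belong to the vertex `j`. -/
def vertexConst (lam : ℝ) (k : ℕ) (u : ℝ) : ℝ≥0∞ :=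
  gammaFactor (lam - ((k : ℝ) + 2) / 2) u * ENNReal.ofReal ((Real.pi * u) ^ ((k : ℝ) / 2))

theorem measurable_vertexFactor {G : SimpleGraph (Fin n)} (pa : Fin n → Finset (Fin n))
    (lam : Fin n → ℝ) (Υ : IncompleteMatrix G) (j : Fin n) :
    Measurable (vertexFactor pa lam Υ j) :=
  measurable_vertexDensity _ _ (measurable_condVar measurable_toMatrix_apply _ _)
    (measurable_residualForm measurable_toMatrix_apply _ _ _)
    (measurable_det_of_entries fun _ _ => measurable_toMatrix_apply _ _)

theorem residualForm_congr {V : Type*} [Fintype V] [DecidableEq V] {M N : Matrix V V ℝ} {j : V}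
    {A : Finset V} (c : A → ℝ)
    (h : ∀ a ∈ insert j A, ∀ b ∈ insert j A, M a b = N a b) :
    residualForm M j A c = residualForm N j A c := by
  have hj := Finset.mem_insert_self j A
  have hA : ∀ a : A, (a : V) ∈ insert j A := fun a => Finset.mem_insert_of_mem a.2
  have h1 : principal M A = principal N A := by
    ext a b
    exact h _ (hA a) _ (hA b)
  have h3 : (fun a : A => M a j) = fun a : A => N a j := funext fun a => h _ (hA a) _ hj
  unfold residualForm
  rw [h1, h3, h _ hj _ hj]

theorem vertexFactor_congr {G : SimpleGraph (Fin n)} (pa : Fin n → Finset (Fin n))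
    (lam : Fin n → ℝ) (Υ : IncompleteMatrix G) (j : Fin n) {Γ Γ' : IncompleteMatrix G}
    (h : ∀ a ∈ insert j (pa j), ∀ b ∈ insert j (pa j), Γ.toMatrix a b = Γ'.toMatrix a b) :
    vertexFactor pa lam Υ j Γ = vertexFactor pa lam Υ j Γ' := by
  have h1 : principal Γ.toMatrix (pa j) = principal Γ'.toMatrix (pa j) := by
    ext a b
    exact h _ (Finset.mem_insert_of_mem a.2) _ (Finset.mem_insert_of_mem b.2)
  rw [vertexFactor, vertexFactor, condVar_congr h, residualForm_congr _ h, h1]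

namespace IsOrderedPerfectDAG

variable {pa : Fin n → Finset (Fin n)} {G : SimpleGraph (Fin n)}

theorem measurableSet_coneQ (h : IsOrderedPerfectDAG pa G) : MeasurableSet (coneQ G) := by
  have : coneQ G = ⋂ j, {Γ | 0 < condVar Γ.toMatrix j (pa j)} := by
    ext Γ
    rw [h.mem_coneQ_iff, Set.mem_iInter]
    rfl
  rw [this]
  exact MeasurableSet.iInter fun j =>
    measurableSet_lt measurable_const (measurable_condVar measurable_toMatrix_apply _ _)

/-- The coordinate of the edge between `j` and its parent `p`. -/
def parentIdx (h : IsOrderedPerfectDAG pa G) (j : Fin n) (p : pa j) : EdgeIdx G :=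
  edgeIdx (Or.inr (h.adj p.2))

/-- The coordinate of the diagonal entry at `j`. -/
def _root_.diagIdx (G : SimpleGraph (Fin n)) (j : Fin n) : EdgeIdx G :=
  edgeIdx (i := j) (j := j) (Or.inl rfl)

/-- The smaller end of an edge. -/
def _root_.lowerEnd (e : EdgeIdx G) : Fin n := e.1.inf

theorem _root_.lowerEnd_edgeIdx {i j : Fin n} (h : i = j ∨ G.Adj i j) :
    lowerEnd (edgeIdx h) = i ⊓ j := rfl

theorem parentIdx_injective (h : IsOrderedPerfectDAG pa G) (j : Fin n) :
    Function.Injective (h.parentIdx j) := by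
  intro p q hpq
  have h1 : s(j, (p : Fin n)) = s(j, (q : Fin n)) := congrArg Subtype.val hpq
  exact Subtype.ext (Sym2.congr_right.1 h1)

theorem parentIdx_ne_diagIdx (h : IsOrderedPerfectDAG pa G) (j : Fin n) (p : pa j) :
    h.parentIdx j p ≠ diagIdx G j := by
  intro hp
  have h1 : s(j, (p : Fin n)) = s(j, j) := congrArg Subtype.val hp
  exact (h.lt j p p.2).ne (Sym2.congr_right.1 h1).symm

open Classical in
-- Sorting coordinates by their smaller end partitions them into the blocks Σ_jj, Σ_{j,pa(j)}.
theorem filter_lowerEnd_eq (h : IsOrderedPerfectDAG pa G) (j : Fin n) :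
    (Finset.univ.filter fun e : EdgeIdx G => lowerEnd e = j) =
      insert (diagIdx G j) (Finset.univ.image (h.parentIdx j)) := by
  ext e
  simp only [Finset.mem_filter, Finset.mem_univ, true_and, Finset.mem_insert, Finset.mem_image]
  constructor
  · obtain ⟨e, he⟩ := e
    induction e using Sym2.ind with
    | _ a b =>
      have hab : a = b ∨ G.Adj a b := by simpa using he
      intro hj
      change a ⊓ b = j at hj
      rcases lt_trichotomy a b with hlt | rfl | hlt
      · rw [inf_eq_left.2 hlt.le] at hj
        subst hj
        exact Or.inr ⟨⟨b, h.mem_pa_of_adj (hab.resolve_left hlt.ne) hlt⟩, rfl⟩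
      · rw [inf_idem] at hj
        subst hj
        exact Or.inl rfl
      · rw [inf_eq_right.2 hlt.le] at hj
        subst hj
        exact Or.inr ⟨⟨a, h.mem_pa_of_adj (hab.resolve_left hlt.ne').symm hlt⟩,
          Subtype.ext Sym2.eq_swap⟩
  · rintro (rfl | ⟨p, rfl⟩)
    · exact inf_idem _
    · exact inf_eq_left.2 (h.lt j p p.2).le

open Classical in
-- The entries among the parents have lower end above j and stay fixed, so the one-vertex integral
-- applies with P = Σ_{pa(j)}.
theorem lmarginal_vertexFactor (h : IsOrderedPerfectDAG pa G) (lam : Fin n → ℝ)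
    {Υ : IncompleteMatrix G} (hΥ : Υ ∈ coneQ G) (j : Fin n) {Γ : IncompleteMatrix G}
    (hP : (principal Γ.toMatrix (pa j)).PosDef) :
    lmarginal (fun _ => (volume : Measure ℝ))
        (Finset.univ.filter fun e : EdgeIdx G => lowerEnd e = j) (vertexFactor pa lam Υ j) Γ =
      vertexConst (lam j) (pa j).card (condVar Υ.toMatrix j (pa j)) := by
  have hu := (h.mem_coneQ_iff Υ).1 hΥ j
  have hdiag : diagIdx G j ∉ Finset.univ.image (h.parentIdx j) := by
    simp only [Finset.mem_image, not_exists, not_and]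
    exact fun p _ => h.parentIdx_ne_diagIdx j p
  let e : pa j ≃ (Finset.univ.image (h.parentIdx j) : Finset (EdgeIdx G)) :=
    Equiv.ofBijective (fun p => ⟨h.parentIdx j p, Finset.mem_image_of_mem _ (Finset.mem_univ p)⟩)
      ⟨fun p q hpq => h.parentIdx_injective j (congrArg Subtype.val hpq), fun ⟨x, hx⟩ => by
        obtain ⟨p, _, hp⟩ := Finset.mem_image.1 hx
        exact ⟨p, Subtype.ext hp⟩⟩
  rw [h.filter_lowerEnd_eq, lmarginal_insert' _ (measurable_vertexFactor pa lam Υ j) hdiag,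
    lmarginal, ← (measurePreserving_piCongrLeft (α := fun _ => ℝ)
      (fun _ => (volume : Measure ℝ)) e).lintegral_comp_emb
      (MeasurableEquiv.measurableEmbedding _)]
  have hint := lintegral_vertexDensity hP (regCoef Υ.toMatrix j (pa j))
    (lam j - (((pa j).card : ℝ) + 2) / 2) hu
  rw [Fintype.card_coe] at hint
  rw [vertexConst, ← hint]
  refine lintegral_congr fun v => lintegral_congr fun s => ?_
  set Γ' : IncompleteMatrix G := Function.update (Function.updateFinset Γ
    (Finset.univ.image (h.parentIdx j)) (MeasurableEquiv.piCongrLeft (fun _ => ℝ) e v))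
    (diagIdx G j) s with hΓ'
  have hjj : Γ'.toMatrix j j = s := by
    rw [toMatrix_apply Γ' (Or.inl rfl)]
    exact Function.update_self _ _ _
  have hjp : ∀ p : pa j, Γ'.toMatrix j p = v p := by
    intro p
    have hne : edgeIdx (Or.inr (h.adj p.2)) ≠ diagIdx G j := h.parentIdx_ne_diagIdx j p
    have hmem : edgeIdx (Or.inr (h.adj p.2)) ∈ Finset.univ.image (h.parentIdx j) :=
      Finset.mem_image_of_mem (h.parentIdx j) (Finset.mem_univ p)
    rw [toMatrix_apply Γ' (Or.inr (h.adj p.2)), hΓ', Function.update_of_ne hne, Function.updateFinset,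
      dif_pos hmem]
    exact MeasurableEquiv.piCongrLeft_apply_apply (β := fun _ => ℝ) e v p
  have hpq : principal Γ'.toMatrix (pa j) = principal Γ.toMatrix (pa j) := by
    ext p q
    have hadj := h.eq_or_adj (Finset.mem_insert_of_mem p.2) (Finset.mem_insert_of_mem q.2)
    have hne : lowerEnd (edgeIdx hadj) ≠ j := by
      rw [lowerEnd_edgeIdx]
      exact (lt_inf_iff.2 ⟨h.lt j p p.2, h.lt j q q.2⟩).ne'
    have hmem : edgeIdx hadj ∉ insert (diagIdx G j) (Finset.univ.image (h.parentIdx j)) := by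
      rw [← h.filter_lowerEnd_eq, Finset.mem_filter]
      exact fun hm => hne hm.2
    rw [Finset.mem_insert, not_or] at hmem
    rw [principal_apply, principal_apply, toMatrix_apply Γ' hadj, toMatrix_apply Γ hadj, hΓ',
      Function.update_of_ne hmem.1, Function.updateFinset, dif_neg hmem.2]
  have hpj : (fun p : pa j => Γ'.toMatrix p j) = v := by
    ext p
    rw [(toMatrix_isSymm Γ').apply, hjp]
  have hjp' : (fun p : pa j => Γ'.toMatrix j p) = v := funext hjp
  have hcond : condVar Γ'.toMatrix j (pa j) = s - v ⬝ᵥ ((principal Γ.toMatrix (pa j))⁻¹ *ᵥ v) := by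
    rw [condVar, hpq, hpj, hjp', hjj]
  rw [vertexFactor, hcond, residualForm, hpq, hpj, hjj]

open Classical in
theorem vertexFactor_updateFinset (h : IsOrderedPerfectDAG pa G) (lam : Fin n → ℝ)
    (Υ : IncompleteMatrix G) {j k : Fin n} (hjk : j < k) (Γ : IncompleteMatrix G)
    (y : (Finset.univ.filter fun e : EdgeIdx G => lowerEnd e = j) → ℝ) :
    vertexFactor pa lam Υ k (Function.updateFinset Γ _ y) = vertexFactor pa lam Υ k Γ := by
  refine vertexFactor_congr pa lam Υ k fun a ha b hb => ?_
  have hadj := h.eq_or_adj ha hb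
  have hle : ∀ a ∈ insert k (pa k), k ≤ a := fun a ha =>
    (Finset.mem_insert.1 ha).elim (fun h => h.ge) fun ha => (h.lt k a ha).le
  have hne : lowerEnd (edgeIdx hadj) ≠ j := by
    rw [lowerEnd_edgeIdx]
    exact (hjk.trans_le (le_inf (hle a ha) (hle b hb))).ne'
  rw [toMatrix_apply _ hadj, toMatrix_apply _ hadj, Function.updateFinset, dif_neg]
  rw [Finset.mem_filter]
  exact fun hm => hne hm.2

open Classical in
-- Factors of later vertices do not see the coordinates of j and come out of the integral.
theorem lmarginal_prod_vertexFactor (h : IsOrderedPerfectDAG pa G) (lam : Fin n → ℝ)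
    {Υ : IncompleteMatrix G} (hΥ : Υ ∈ coneQ G) (j : Fin n) (Γ : IncompleteMatrix G) :
    lmarginal (fun _ => (volume : Measure ℝ))
        (Finset.univ.filter fun e : EdgeIdx G => lowerEnd e = j)
        (fun Γ => ∏ k ∈ Finset.Ici j, vertexFactor pa lam Υ k Γ) Γ =
      vertexConst (lam j) (pa j).card (condVar Υ.toMatrix j (pa j)) *
        ∏ k ∈ Finset.Ioi j, vertexFactor pa lam Υ k Γ := by
  have hsplit : ∀ y, ∏ k ∈ Finset.Ici j, vertexFactor pa lam Υ k (Function.updateFinset Γ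
      (Finset.univ.filter fun e : EdgeIdx G => lowerEnd e = j) y) =
      vertexFactor pa lam Υ j (Function.updateFinset Γ _ y) *
        ∏ k ∈ Finset.Ioi j, vertexFactor pa lam Υ k Γ := by
    intro y
    rw [← Finset.Ioi_insert, Finset.prod_insert Finset.notMem_Ioi_self]
    congr 1
    exact Finset.prod_congr rfl fun k hk =>
      h.vertexFactor_updateFinset lam Υ (Finset.mem_Ioi.1 hk) Γ y
  rw [lmarginal]
  simp only [hsplit]
  have hmeas : Measurable fun y => vertexFactor pa lam Υ j (Function.updateFinset Γ
      (Finset.univ.filter fun e : EdgeIdx G => lowerEnd e = j) y) :=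
    (measurable_vertexFactor pa lam Υ j).comp measurable_updateFinset
  rw [lintegral_mul_const _ hmeas]
  -- If a later conditional variance is not positive, Σ_{pa(j)} may fail to be positive definite,
  -- but then a later factor is 0 and both sides vanish, even against an infinite constant.
  by_cases hpos : ∀ k, j < k → 0 < condVar Γ.toMatrix k (pa k)
  · congr 1
    exact h.lmarginal_vertexFactor lam hΥ j
      (h.principal_pa_posDef (toMatrix_isSymm Γ) j hpos)
  · push Not at hpos
    obtain ⟨k, hjk, hk⟩ := hpos
    have h0 : ∏ k ∈ Finset.Ioi j, vertexFactor pa lam Υ k Γ = 0 :=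
      Finset.prod_eq_zero (Finset.mem_Ioi.2 hjk) (if_neg hk.not_gt)
    rw [h0, mul_zero, mul_zero]

open Classical in
theorem lmarginal_lowerEnd_lt (h : IsOrderedPerfectDAG pa G) (lam : Fin n → ℝ)
    {Υ : IncompleteMatrix G} (hΥ : Υ ∈ coneQ G) (m : ℕ) (hm : m ≤ n) (Γ : IncompleteMatrix G) :
    lmarginal (fun _ => (volume : Measure ℝ))
        (Finset.univ.filter fun e : EdgeIdx G => (lowerEnd e : ℕ) < m)
        (fun Γ => ∏ k, vertexFactor pa lam Υ k Γ) Γ =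
      (∏ k ∈ Finset.univ.filter (fun k : Fin n => (k : ℕ) < m),
          vertexConst (lam k) (pa k).card (condVar Υ.toMatrix k (pa k))) *
        ∏ k ∈ Finset.univ.filter (fun k : Fin n => m ≤ (k : ℕ)), vertexFactor pa lam Υ k Γ := by
  have hmeas : ∀ s : Finset (Fin n), Measurable fun Γ : IncompleteMatrix G =>
      ∏ k ∈ s, vertexFactor pa lam Υ k Γ := fun s =>
    Finset.measurable_fun_prod _ fun k _ => measurable_vertexFactor pa lam Υ k
  induction m generalizing Γ with
  | zero => simp
  | succ m ih =>
    set j : Fin n := ⟨m, hm⟩ with hj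
    have hunion : (Finset.univ.filter fun e : EdgeIdx G => (lowerEnd e : ℕ) < m + 1) =
        (Finset.univ.filter fun e : EdgeIdx G => (lowerEnd e : ℕ) < m) ∪
          Finset.univ.filter fun e : EdgeIdx G => lowerEnd e = j := by
      ext e
      simp only [Finset.mem_filter, Finset.mem_univ, true_and, Finset.mem_union, hj, Fin.ext_iff]
      omega
    have hdisj : Disjoint (Finset.univ.filter fun e : EdgeIdx G => (lowerEnd e : ℕ) < m)
        (Finset.univ.filter fun e : EdgeIdx G => lowerEnd e = j) := by
      rw [Finset.disjoint_filter]
      rintro e _ h1 h2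
      rw [h2] at h1
      exact lt_irrefl _ h1
    have hIci : (Finset.univ.filter fun k : Fin n => m ≤ (k : ℕ)) = Finset.Ici j := by
      ext k
      simp [hj, Fin.le_def]
    have hIoi : (Finset.univ.filter fun k : Fin n => m + 1 ≤ (k : ℕ)) = Finset.Ioi j := by
      ext k
      simp [hj, Fin.lt_def]
    have hlow : (Finset.univ.filter fun k : Fin n => (k : ℕ) < m + 1) =
        insert j (Finset.univ.filter fun k : Fin n => (k : ℕ) < m) := by
      ext k
      simp only [Finset.mem_filter, Finset.mem_univ, true_and, Finset.mem_insert, hj, Fin.ext_iff]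
      omega
    have hjmem : j ∉ Finset.univ.filter fun k : Fin n => (k : ℕ) < m := by simp [hj]
    have hmeas' : Measurable fun y => ∏ k ∈ Finset.Ici j, vertexFactor pa lam Υ k
        (Function.updateFinset Γ (Finset.univ.filter fun e : EdgeIdx G => lowerEnd e = j) y) :=
      (hmeas _).comp measurable_updateFinset
    rw [hunion, lmarginal_union' _ _ (hmeas _) hdisj,
      show lmarginal (fun _ => (volume : Measure ℝ)) (Finset.univ.filter fun e : EdgeIdx G =>
        (lowerEnd e : ℕ) < m) (fun Γ => ∏ k, vertexFactor pa lam Υ k Γ) = _ from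
        funext fun Γ => ih (Nat.le_of_succ_le hm) Γ, hIoi, hlow, Finset.prod_insert hjmem, hIci,
      lmarginal, lintegral_const_mul _ hmeas']
    have hstep := h.lmarginal_prod_vertexFactor lam hΥ j Γ
    rw [lmarginal] at hstep
    rw [hstep]
    ring

theorem lintegral_prod_vertexFactor (h : IsOrderedPerfectDAG pa G) (lam : Fin n → ℝ)
    {Υ : IncompleteMatrix G} (hΥ : Υ ∈ coneQ G) :
    ∫⁻ Γ : IncompleteMatrix G, ∏ k, vertexFactor pa lam Υ k Γ =
      ∏ k, vertexConst (lam k) (pa k).card (condVar Υ.toMatrix k (pa k)) := by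
  classical
  have h1 := h.lmarginal_lowerEnd_lt lam hΥ n le_rfl Υ
  simp only [Fin.is_lt, Finset.filter_true, not_le.2 (Fin.is_lt _), Finset.filter_false,
    Finset.prod_empty, mul_one, lmarginal_univ] at h1
  exact h1

theorem rieszIntegral_eq (h : IsOrderedPerfectDAG pa G) (lam : Fin n → ℝ)
    {Υ : IncompleteMatrix G} (hΥ : Υ ∈ coneQ G) :
    rieszIntegral pa lam Υ =
      ∏ k, vertexConst (lam k) (pa k).card (condVar Υ.toMatrix k (pa k)) := by
  rw [← h.lintegral_prod_vertexFactor lam hΥ, rieszIntegral,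
    ← lintegral_indicator h.measurableSet_coneQ]
  refine lintegral_congr fun Γ => ?_
  by_cases hΓ : Γ ∈ coneQ G
  · have hpos := (h.mem_coneQ_iff Γ).1 hΓ
    rw [Set.indicator_of_mem hΓ, h.expTrace_eq hΥ hΓ, rieszBase, ← Finset.prod_mul_distrib,
      ← Finset.prod_mul_distrib]
    rw [ENNReal.ofReal_prod_of_nonneg]
    · refine Finset.prod_congr rfl fun j _ => ?_
      rw [vertexFactor, vertexDensity, if_pos (hpos j), sub_eq_add_neg, Real.rpow_add (hpos j),
        neg_div]
      congr 1
      ring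
    · intro j _
      have hdet := (h.principal_pa_posDef (toMatrix_isSymm Γ) j fun k _ => hpos k).det_pos
      have := hpos j
      positivity
  -- Outside the cone some conditional variance is not positive, so its vertex factor is 0 by
  -- definition.
  · rw [Set.indicator_of_notMem hΓ]
    rw [h.mem_coneQ_iff] at hΓ
    push Not at hΓ
    obtain ⟨j, hj⟩ := hΓ
    exact (Finset.prod_eq_zero (Finset.mem_univ j) (if_neg hj.not_gt)).symm

end IsOrderedPerfectDAG

/-- The Gamma part gives u^(λ - k/2) and the Gaussian part u^(k/2). The exponents add up to λ, hence
the proportionality to ∏ U_{jj|pa(j)}^{λ_j}. -/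
theorem vertexConst_eq {lam : ℝ} {k : ℕ} {u : ℝ} (hlam : (k : ℝ) / 2 < lam) (hu : 0 < u) :
    vertexConst lam k u = ENNReal.ofReal
      (Real.Gamma (lam - (k : ℝ) / 2) * Real.pi ^ ((k : ℝ) / 2) * u ^ lam) := by
  have h1 : lam - ((k : ℝ) + 2) / 2 + 1 = lam - (k : ℝ) / 2 := by ring
  have hg : 0 < Real.Gamma (lam - (k : ℝ) / 2) := Real.Gamma_pos_of_pos (by linarith)
  rw [vertexConst, gammaFactor_eq (by linarith) hu, h1, ← ENNReal.ofReal_mul (by positivity),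
    Real.mul_rpow Real.pi_pos.le hu.le]
  congr 1
  have h2 : u ^ lam = u ^ (lam - (k : ℝ) / 2) * u ^ ((k : ℝ) / 2) := by
    rw [← Real.rpow_add hu, sub_add_cancel]
  rw [h2]
  ring

theorem vertexConst_eq_top {lam : ℝ} {k : ℕ} {u : ℝ} (hlam : lam ≤ (k : ℝ) / 2) (hu : 0 < u) :
    vertexConst lam k u = ∞ := by
  rw [vertexConst, gammaFactor_eq_top (by linarith) hu, ENNReal.top_mul]
  exact (ENNReal.ofReal_pos.2 (by positivity)).ne'

/-- Ensures that one infinite factor makes the whole product infinite. -/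
theorem vertexConst_ne_zero (lam : ℝ) (k : ℕ) {u : ℝ} (hu : 0 < u) : vertexConst lam k u ≠ 0 := by
  rcases le_or_gt lam ((k : ℝ) / 2) with hlam | hlam
  · rw [vertexConst_eq_top hlam hu]
    exact ENNReal.top_ne_zero
  · rw [vertexConst_eq hlam hu]
    have hg : 0 < Real.Gamma (lam - (k : ℝ) / 2) := Real.Gamma_pos_of_pos (by linarith)
    exact (ENNReal.ofReal_pos.2 (by positivity)).ne'

namespace IsOrderedPerfectDAG

variable {pa : Fin n → Finset (Fin n)} {G : SimpleGraph (Fin n)}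

theorem rieszIntegral_lt_top_iff (h : IsOrderedPerfectDAG pa G) (lam : Fin n → ℝ)
    {Υ : IncompleteMatrix G} (hΥ : Υ ∈ coneQ G) :
    rieszIntegral pa lam Υ < ∞ ↔ ∀ j, ((pa j).card : ℝ) / 2 < lam j := by
  have hpos := (h.mem_coneQ_iff Υ).1 hΥ
  rw [h.rieszIntegral_eq lam hΥ]
  constructor
  · intro hlt j
    by_contra hj
    exact hlt.ne (WithTop.prod_eq_top (Finset.mem_univ j)
      (vertexConst_eq_top (not_lt.1 hj) (hpos j)) fun k _ => vertexConst_ne_zero _ _ (hpos k))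
  · intro hlam
    refine ENNReal.prod_lt_top fun j _ => ?_
    rw [vertexConst_eq (hlam j) (hpos j)]
    exact ENNReal.ofReal_lt_top

theorem rieszIntegral_eq_ofReal (h : IsOrderedPerfectDAG pa G) {lam : Fin n → ℝ}
    (hlam : ∀ j, ((pa j).card : ℝ) / 2 < lam j) {Υ : IncompleteMatrix G} (hΥ : Υ ∈ coneQ G) :
    rieszIntegral pa lam Υ = ENNReal.ofReal
      ((∏ j, Real.Gamma (lam j - ((pa j).card : ℝ) / 2) * Real.pi ^ (((pa j).card : ℝ) / 2)) *
        ∏ j, condVar Υ.toMatrix j (pa j) ^ lam j) := by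
  have hpos := (h.mem_coneQ_iff Υ).1 hΥ
  rw [h.rieszIntegral_eq lam hΥ, ← Finset.prod_mul_distrib, ENNReal.ofReal_prod_of_nonneg]
  · exact Finset.prod_congr rfl fun j _ => vertexConst_eq (hlam j) (hpos j)
  · intro j _
    have hg : 0 < Real.Gamma (lam j - ((pa j).card : ℝ) / 2) :=
      Real.Gamma_pos_of_pos (by linarith [hlam j])
    have := hpos j
    positivity

end IsOrderedPerfectDAG

end

/-! ### Chordality and acyclicity from a perfect ordering. -/

/-- On an induced cycle, both neighbours of the vertex with the smallest label are its parents,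
hence adjacent. In a cycle of length m + 4 they differ by 2 or m + 2, never by 1. -/
theorem IsOrderedPerfectDAG.isDecomposable {n : ℕ} {pa : Fin n → Finset (Fin n)}
    {G : SimpleGraph (Fin n)} (h : IsOrderedPerfectDAG pa G) : IsDecomposable G := by
  intro l hl
  obtain ⟨m, rfl⟩ := Nat.exists_eq_add_of_le' hl
  refine ⟨fun φ => ?_⟩
  obtain ⟨i, hi⟩ := Finite.exists_min φ
  have hpa : ∀ k, (SimpleGraph.cycleGraph (m + 4)).Adj i k → φ k ∈ pa (φ i) := fun k hk =>
    h.mem_pa_of_adj (φ.map_adj_iff.2 hk) ((hi k).lt_of_ne (φ.injective.ne hk.ne))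
  have h1 : (1 : Fin (m + 4)).val = 1 := rfl
  have hsucc := hpa (i + 1) (SimpleGraph.cycleGraph_adj'.2 (Or.inr (by
    rw [add_sub_cancel_left, h1])))
  have hpred := hpa (i - 1) (SimpleGraph.cycleGraph_adj'.2 (Or.inl (by
    rw [sub_sub_cancel, h1])))
  have hval : ((i + 1) - (i - 1)).val = 2 := by
    rw [show (i + 1) - (i - 1) = 1 + 1 by abel, Fin.val_add, h1, Nat.mod_eq_of_lt (by omega)]
  have hval' : ((i - 1) - (i + 1)).val = m + 2 := by
    rw [show (i - 1) - (i + 1) = -((i + 1) - (i - 1)) by abel, Fin.val_neg', hval,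
      Nat.mod_eq_of_lt] <;> omega
  have hne : i + 1 ≠ i - 1 := by
    intro heq
    rw [heq, sub_self] at hval
    exact absurd hval (by simp)
  have hadj := h.adj_iff (φ (i + 1)) (φ (i - 1)) |>.2
    (h.perfect _ _ hsucc _ hpred (φ.injective.ne hne))
  rcases SimpleGraph.cycleGraph_adj'.1 (φ.map_adj_iff.1 hadj) with h2 | h2
  · omega
  · omega

theorem IsOrderedPerfectDAG.isDAGVersion {n : ℕ} {pa : Fin n → Finset (Fin n)}
    {G : SimpleGraph (Fin n)} (h : IsOrderedPerfectDAG pa G) : IsDAGVersion pa G := by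
  refine ⟨fun v hv => ?_, h.adj_iff⟩
  have hlt : ∀ a b, Relation.TransGen (fun a b => a ∈ pa b) a b → b < a := by
    intro a b hab
    induction hab with
    | single hab => exact h.lt _ _ hab
    | tail _ hbc ih => exact (h.lt _ _ hbc).trans ih
  exact lt_irrefl _ (hlt v v hv)

/-! ### Separators do not depend on the perfect order. -/

section Separators

variable {V : Type*} [Fintype V] [DecidableEq V] {G : SimpleGraph V} {m m' : ℕ}

namespace PerfectOrder

theorem clique_bijective (P : PerfectOrder G m) : Function.Bijective P.clique :=
  ⟨fun _ _ h => P.injective (congrArg Subtype.val h), fun C => by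
    obtain ⟨j, hj⟩ := (P.isMaxClique_iff C.1).1 C.2
    exact ⟨j, Subtype.ext hj⟩⟩

theorem card_cliqueIdx (P : PerfectOrder G m) : Fintype.card (CliqueIdx G) = m + 1 := by
  rw [← Fintype.card_of_bijective P.clique_bijective, Fintype.card_fin]

theorem card_superset_cliques (P : PerfectOrder G m) (A : Finset V) :
    (Finset.univ.filter fun j => A ⊆ P.C j).card =
      (Finset.univ.filter fun C : CliqueIdx G => A ⊆ C.1).card :=
  Finset.card_bijective _ P.clique_bijective fun j => by
    simp only [Finset.mem_filter, Finset.mem_univ, true_and]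
    rfl

/-- Let C_j be the first clique containing A. Every later clique containing A has A in its
separator, and the running intersection property forbids this for C_j itself. The count on the right
depends only on G. -/
theorem card_superset_separators (P : PerfectOrder G m) {A : Finset V} (hA : ∃ j, A ⊆ P.C j) :
    (Finset.univ.filter fun i => A ⊆ separatorOf P.C i).card + 1 =
      (Finset.univ.filter fun j => A ⊆ P.C j).card := by
  obtain ⟨j, hj⟩ := hA
  have hne : (Finset.univ.filter fun j => A ⊆ P.C j).Nonempty :=
    ⟨j, Finset.mem_filter.2 ⟨Finset.mem_univ _, hj⟩⟩
  set J := Finset.univ.filter fun j => A ⊆ P.C j with hJ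
  have hmem : ∀ j, j ∈ J ↔ A ⊆ P.C j := fun j => by simp [hJ]
  have hsplit : J.erase (J.min' hne) =
      (Finset.univ.filter fun i => A ⊆ separatorOf P.C i).map (Fin.succEmb m) := by
    ext k
    simp only [Finset.mem_erase, Finset.mem_map, Finset.mem_filter, Finset.mem_univ, true_and,
      Fin.coe_succEmb]
    constructor
    · rintro ⟨hk, hkJ⟩
      have hlt : J.min' hne < k := (J.min'_le k hkJ).lt_of_ne (Ne.symm hk)
      obtain ⟨i, rfl⟩ := Fin.exists_succ_eq.2 (Fin.ne_zero_of_lt hlt)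
      refine ⟨i, Finset.subset_inter ((hmem _).1 hkJ) ?_, rfl⟩
      refine ((hmem _).1 (J.min'_mem hne)).trans (Finset.subset_biUnion_of_mem P.C ?_)
      exact Finset.mem_filter.2 ⟨Finset.mem_univ _, Fin.le_castSucc_iff.2 hlt⟩
    · rintro ⟨i, hi, rfl⟩
      refine ⟨fun heq => ?_, (hmem _).2 (hi.trans Finset.inter_subset_left)⟩
      obtain ⟨k, hk, hsub⟩ := P.running i
      have hle := J.min'_le k ((hmem _).2 (hi.trans hsub))
      rw [← heq] at hle
      exact absurd (hle.trans hk) (Fin.castSucc_lt_succ).not_ge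
  rw [← Finset.card_erase_add_one (J.min'_mem hne), hsplit, Finset.card_map]

theorem separatorOf_subset (P : PerfectOrder G m) (i : Fin m) :
    ∃ j, separatorOf P.C i ⊆ P.C j :=
  ⟨i.succ, Finset.inter_subset_left⟩

/-- Every perfect order has the same separators, with the same multiplicities. -/
theorem card_separators_eq (P : PerfectOrder G m) (P' : PerfectOrder G m') (S : Finset V) :
    (Finset.univ.filter fun i => separatorOf P.C i = S).card =
      (Finset.univ.filter fun i => separatorOf P'.C i = S).card := by
  have hsum : ∀ {m : ℕ} (P : PerfectOrder G m) (A : Finset V),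
      (Finset.univ.filter fun i => A ⊆ separatorOf P.C i).card =
        (Finset.univ.filter fun i => separatorOf P.C i = A).card + ∑ T ∈ Finset.Ioi A,
          (Finset.univ.filter fun i => separatorOf P.C i = T).card := by
    intro m P A
    rw [← Finset.sum_insert (s := Finset.Ioi A)
      (f := fun T => (Finset.univ.filter fun i => separatorOf P.C i = T).card)
      Finset.notMem_Ioi_self, Finset.Ioi_insert,
      Finset.card_eq_sum_card_fiberwise (f := separatorOf P.C) (t := Finset.Ici A)]
    · refine Finset.sum_congr rfl fun T hT => ?_
      rw [Finset.filter_filter]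
      congr 1
      ext i
      simp only [Finset.mem_filter, Finset.mem_univ, true_and, and_iff_right_iff_imp]
      rintro rfl
      exact Finset.mem_Ici.1 hT
    · intro i hi
      exact Finset.mem_coe.2 (Finset.mem_Ici.2 (Finset.mem_filter.1 hi).2)
  -- Downward induction on inclusion: the number of separators containing S is known, and so are the
  -- multiplicities of the strictly larger ones.
  induction S using WellFoundedGT.induction with
  | ind S ih =>
    by_cases hS : ∃ j, S ⊆ P.C j
    · have hS' : ∃ j, S ⊆ P'.C j := by
        obtain ⟨j, hj⟩ := hS
        obtain ⟨k, hk⟩ := (P'.isMaxClique_iff _).1 (P.clique j).2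
        exact ⟨k, hk ▸ hj⟩
      have h1 := P.card_superset_separators hS
      have h2 := P'.card_superset_separators hS'
      rw [card_superset_cliques, hsum] at h1 h2
      have h3 := Finset.sum_congr rfl fun T (hT : T ∈ Finset.Ioi S) => ih T (Finset.mem_Ioi.1 hT)
      omega
    · have hzero : ∀ {m : ℕ} (P' : PerfectOrder G m),
          (Finset.univ.filter fun i => separatorOf P'.C i = S).card = 0 := by
        intro m P'
        rw [Finset.card_eq_zero, Finset.filter_eq_empty_iff]
        rintro i - rfl
        obtain ⟨j, hj⟩ := P'.separatorOf_subset i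
        obtain ⟨k, hk⟩ := (P.isMaxClique_iff _).1 (P'.clique j).2
        exact hS ⟨k, hk ▸ hj⟩
      rw [hzero, hzero]

theorem sep_surjective (P : PerfectOrder G m) : Function.Surjective P.sep := by
  rintro ⟨S, m', P', i', rfl⟩
  have hpos : 0 < (Finset.univ.filter fun i => separatorOf P.C i = separatorOf P'.C i').card := by
    rw [P.card_separators_eq P']
    exact Finset.card_pos.2 ⟨i', Finset.mem_filter.2 ⟨Finset.mem_univ _, rfl⟩⟩
  obtain ⟨i, hi⟩ := Finset.card_pos.1 hpos
  exact ⟨i, Subtype.ext (Finset.mem_filter.1 hi).2⟩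

/-- Needed because Hausdorff dimension turns into a supremum only over countable unions. -/
instance : Countable (PerfectOrder G m) := by
  refine Function.Injective.countable (f := fun P : PerfectOrder G m => P.C) ?_
  rintro ⟨C, _, _, _⟩ ⟨C', _, _, _⟩ h
  cases h
  rfl

end PerfectOrder

end Separators

/-! ### Hausdorff dimension of the union of the sets A_P. -/

noncomputable section

section Dimension

variable {V : Type*} [Fintype V] [DecidableEq V] {G : SimpleGraph V} {m : ℕ}

open Classical in
/-- The shape parameters with `δ_S = 0` for `S ≠ S₂`, parametrised by `α` and `β(S₂)`. -/
def balancedParam (P : PerfectOrder G (m + 1)) :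
    ((CliqueIdx G → ℝ) × ℝ) →ₗ[ℝ] ShapeParam G where
  toFun x := (x.1, fun S => if S = P.sep 0 then x.2 else
    (∑ i ∈ Finset.univ.filter (fun i => P.sep i = S), x.1 (P.clique i.succ)) /
      ((Finset.univ.filter (fun i => P.sep i = S)).card : ℝ))
  map_add' x y := by
    ext S
    · rfl
    · by_cases hS : S = P.sep 0
      · simp [hS]
      · simp [hS, Finset.sum_add_distrib, add_div]
  map_smul' c x := by
    ext S
    · rfl
    · by_cases hS : S = P.sep 0
      · simp [hS]
      · simp [hS, ← Finset.mul_sum, mul_div_assoc]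

theorem sepDefect_balancedParam (P : PerfectOrder G (m + 1)) (x : (CliqueIdx G → ℝ) × ℝ)
    {S : SepIdx G} (hS : S ≠ P.sep 0) : sepDefect P (balancedParam P x) S = 0 := by
  obtain ⟨i, hi⟩ := P.sep_surjective S
  classical
  have hcard : ((Finset.univ.filter (fun i => P.sep i = S)).card : ℝ) ≠ 0 := by
    rw [Nat.cast_ne_zero, ← Nat.pos_iff_ne_zero]
    exact Finset.card_pos.2 ⟨i, Finset.mem_filter.2 ⟨Finset.mem_univ _, hi⟩⟩
  simp only [sepDefect, balancedParam, LinearMap.coe_mk, AddHom.coe_mk, if_neg hS]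
  rw [sub_eq_zero]
  convert! (mul_div_cancel₀ _ hcard).symm using 1

/-- Each S occurs among the separators of P, so ν(S) > 0 and δ_S = 0 can be solved for β(S). -/
theorem setAP_subset_range (P : PerfectOrder G (m + 1)) :
    setAP P ⊆ Set.range (balancedParam P) := by
  intro θ hθ
  refine ⟨(θ.1, θ.2 (P.sep 0)), ?_⟩
  classical
  refine Prod.ext rfl (funext fun S => ?_)
  by_cases hS : S = P.sep 0
  · simp [balancedParam, hS]
  · obtain ⟨i, hi⟩ := P.sep_surjective S
    have hcard : ((Finset.univ.filter (fun i => P.sep i = S)).card : ℝ) ≠ 0 := by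
      rw [Nat.cast_ne_zero, ← Nat.pos_iff_ne_zero]
      exact Finset.card_pos.2 ⟨i, Finset.mem_filter.2 ⟨Finset.mem_univ _, hi⟩⟩
    have h0 := hθ.1 S hS
    simp only [balancedParam, LinearMap.coe_mk, AddHom.coe_mk, if_neg hS]
    rw [div_eq_iff]
    · rw [sepDefect, sub_eq_zero] at h0
      rw [mul_comm]
      convert h0
    · convert hcard

theorem dimH_le_of_subset_range {E F : Type*} [NormedAddCommGroup E] [NormedSpace ℝ E]
    [FiniteDimensional ℝ E] [NormedAddCommGroup F] [NormedSpace ℝ F] (T : E →ₗ[ℝ] F) {s : Set F}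
    (hs : s ⊆ Set.range T) : dimH s ≤ Module.finrank ℝ E :=
  calc dimH s ≤ dimH (Set.range T) := dimH_mono hs
    _ ≤ dimH (Set.univ : Set E) :=
      (LinearMap.toContinuousLinearMap T).lipschitz.dimH_range_le
    _ = Module.finrank ℝ E := Real.dimH_univ_eq_finrank E

/-- A set whose preimage under a section of a linear map has nonempty interior. -/
theorem finrank_le_dimH {E F : Type*} [NormedAddCommGroup E] [NormedSpace ℝ E]
    [FiniteDimensional ℝ E] [NormedAddCommGroup F] [NormedSpace ℝ F] [FiniteDimensional ℝ F]
    (T : E →ₗ[ℝ] F) (p : F →ₗ[ℝ] E) (hp : ∀ x, p (T x) = x) {s : Set F} {t : Set F}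
    (ht : IsOpen t) (hne : ∃ x, T x ∈ t) (hs : ∀ x, T x ∈ t → T x ∈ s) :
    (Module.finrank ℝ E : ℝ≥0∞) ≤ dimH s := by
  have hopen : IsOpen (T ⁻¹' t) := ht.preimage (LinearMap.toContinuousLinearMap T).continuous
  have hint : (interior (T ⁻¹' t)).Nonempty := by
    rw [hopen.interior_eq]
    exact hne
  calc (Module.finrank ℝ E : ℝ≥0∞) = dimH (T ⁻¹' t) := (Real.dimH_of_nonempty_interior hint).symm
    _ ≤ dimH (p '' s) := dimH_mono fun x hx => ⟨T x, hs x hx, hp x⟩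
    _ ≤ dimH s := (LinearMap.toContinuousLinearMap p).lipschitz.dimH_image_le s

/-- There are m + 2 free values of α and one of β(S₂). The remaining conditions defining A_P are
open and satisfiable, so the dimension is attained. -/
theorem dimH_unionAP (P : PerfectOrder G (m + 1)) :
    dimH (unionAP G) = (m + 3 : ℕ) := by
  have hfin : Module.finrank ℝ ((CliqueIdx G → ℝ) × ℝ) = m + 3 := by
    rw [Module.finrank_prod, Module.finrank_fintype_fun_eq_card, Module.finrank_self,
      P.card_cliqueIdx]
  refine le_antisymm ?_ ?_
  · rw [unionAP, dimH_iUnion]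
    refine iSup_le fun l => ?_
    rw [dimH_iUnion]
    refine iSup_le fun Q => ?_
    rw [← hfin]
    exact dimH_le_of_subset_range _ (setAP_subset_range Q)
  · rw [← hfin]
    let p : ShapeParam G →ₗ[ℝ] (CliqueIdx G → ℝ) × ℝ :=
      (LinearMap.fst ℝ _ _).prod ((LinearMap.proj (P.sep 0)).comp (LinearMap.snd ℝ _ _))
    let t : Set (ShapeParam G) := {θ |
      (∀ j, 0 < θ.1 (P.clique j) - (((P.C j).card : ℝ) - 1) / 2) ∧
      (((separatorOf P.C 0).card : ℝ) - 1) / 2 < θ.1 (P.clique 0) + sepDefect P θ (P.sep 0)}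
    have ht : IsOpen t := by
      have h1 : ∀ C, Continuous fun θ : ShapeParam G => θ.1 C := fun C => by fun_prop
      have h2 : ∀ S, Continuous fun θ : ShapeParam G => θ.2 S := fun S => by fun_prop
      have h3 : IsOpen {θ : ShapeParam G | ∀ j,
          0 < θ.1 (P.clique j) - (((P.C j).card : ℝ) - 1) / 2} := by
        rw [Set.ofPred_forall]
        exact isOpen_iInter_of_finite fun j =>
          isOpen_lt continuous_const ((h1 _).sub continuous_const)
      exact h3.inter (isOpen_lt continuous_const ((h1 _).add
        ((continuous_finsetSum _ fun i _ => h1 _).sub ((h2 _).const_mul _))))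
    refine finrank_le_dimH (balancedParam P) p (fun x => ?_) ht ?_ fun x hx => ?_
    · refine Prod.ext rfl ?_
      simp [p, balancedParam]
    · have hcard : ∀ A : Finset V, (A.card : ℝ) ≤ Fintype.card V := fun A =>
        Nat.cast_le.2 A.card_le_univ
      -- Every α exceeds all the size bounds, and β(S₂) = 0 makes the defect at S₂ nonnegative.
      refine ⟨(fun _ => (Fintype.card V : ℝ) + 1, 0), fun j => ?_, ?_⟩
      · have := hcard (P.C j)
        have h0 : (0 : ℝ) ≤ (P.C j).card := Nat.cast_nonneg _
        simp only [balancedParam, LinearMap.coe_mk, AddHom.coe_mk]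
        linarith
      · have := hcard (separatorOf P.C 0)
        have h0 : (0 : ℝ) ≤ (separatorOf P.C 0).card := Nat.cast_nonneg _
        simp only [sepDefect, balancedParam, LinearMap.coe_mk, AddHom.coe_mk, if_true, mul_zero,
          sub_zero, Finset.sum_const, nsmul_eq_mul]
        have h1 : (0 : ℝ) ≤ Fintype.card V := Nat.cast_nonneg _
        have h2 : ∀ k : ℕ, (0 : ℝ) ≤ (k : ℝ) * ((Fintype.card V : ℝ) + 1) := fun k => by positivity
        refine lt_of_lt_of_le ?_ (le_add_of_nonneg_right (h2 _))
        linarith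
    · exact Set.mem_iUnion.2 ⟨m, Set.mem_iUnion.2 ⟨P, fun S hS => sepDefect_balancedParam P x hS,
        hx.1, hx.2⟩⟩

end Dimension

end

/-! ### The graph on eight vertices: its DAG, Markov ratio and Wishart integral. -/

theorem exPa_isOrderedPerfectDAG : IsOrderedPerfectDAG exPa exGraph where
  adj_iff v w := by
    rw [exGraph_adj_iff]
    revert v w
    decide
  perfect := by
    unfold IsPerfectDAG
    decide
  lt := by decide

/-- In the labels 1 to 8, the path 5-6-8-7 is induced, so the closed neighbourhoods of 6 and 8 are
not nested. -/
theorem exGraph_not_isHomogeneous : ¬ IsHomogeneous exGraph := by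
  rintro ⟨-, h⟩
  have hadj : ∀ a b, (a ≠ b ∧ ∃ j, a ∈ exCliques j ∧ b ∈ exCliques j) → exGraph.Adj a b :=
    fun a b => (exGraph_adj_iff a b).2
  have hnot : ∀ a b, ¬ (a ≠ b ∧ ∃ j, a ∈ exCliques j ∧ b ∈ exCliques j) → ¬ exGraph.Adj a b :=
    fun a b hab => mt (exGraph_adj_iff a b).1 hab
  rcases h 5 7 (hadj 5 7 (by decide)) with h | h
  · rcases h (Set.mem_insert_of_mem _ (hadj 7 6 (by decide))) with h | h
    · exact absurd h (by decide)
    · exact hnot 5 6 (by decide) h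
  · rcases h (Set.mem_insert_of_mem _ (hadj 5 4 (by decide))) with h | h
    · exact absurd h (by decide)
    · exact hnot 7 4 (by decide) h

theorem exPa_isInducedBy : IsInducedBy exPa exOrder := by
  unfold IsInducedBy IsAncestral
  change ∀ j, ∀ v ∈ historyOf exCliques j, exPa v ⊆ historyOf exCliques j
  decide

theorem separatorOf_exCliques : separatorOf exCliques = ![{6, 7}, {7}, {5}, {4, 5}] := by
  decide

section MarkovRatio

theorem det_principal_empty {V : Type*} [Fintype V] [DecidableEq V] (M : Matrix V V ℝ) :
    (principal M ∅).det = 1 := Matrix.det_isEmpty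

/-- Logarithmic coordinates turn identities between products of powers into linear ones. Σ_66 gets
its own coordinate w, as it is not a conditional variance of the DAG. -/
theorem exists_exp_eq_dets {Γ : IncompleteMatrix exGraph} (hΓ : Γ ∈ coneQ exGraph) :
    ∃ (t : Fin 8 → ℝ) (w : ℝ), (∀ j, condVar Γ.toMatrix j (exPa j) = Real.exp (t j)) ∧
      Γ.toMatrix 5 5 = Real.exp w ∧
      (principal Γ.toMatrix ∅).det = 1 ∧
      (principal Γ.toMatrix {5}).det = Real.exp w ∧
      (principal Γ.toMatrix {7}).det = Real.exp (t 7) ∧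
      (principal Γ.toMatrix {5, 7}).det = Real.exp (t 5 + t 7) ∧
      (principal Γ.toMatrix {6, 7}).det = Real.exp (t 6 + t 7) ∧
      (principal Γ.toMatrix {4, 5}).det = Real.exp (t 4 + w) ∧
      (principal Γ.toMatrix {0, 4, 5}).det = Real.exp (t 0 + (t 4 + w)) ∧
      (principal Γ.toMatrix {1, 4, 5}).det = Real.exp (t 1 + (t 4 + w)) ∧
      (principal Γ.toMatrix {2, 6, 7}).det = Real.exp (t 2 + (t 6 + t 7)) ∧
      (principal Γ.toMatrix {3, 6, 7}).det = Real.exp (t 3 + (t 6 + t 7)) := by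
  have hpos := (exPa_isOrderedPerfectDAG.mem_coneQ_iff Γ).1 hΓ
  set M := Γ.toMatrix with hM
  have hsing : ∀ i : Fin 8, (principal M {i}).det = M i i := fun i =>
    Matrix.det_unique (principal M {i})
  have h5 : 0 < M 5 5 := by
    rw [← hsing]
    refine (principal_posDef_of_mem_coneQ hΓ ?_).det_pos
    simp
  have hσ : ∀ j, ∃ t, condVar M j (exPa j) = Real.exp t := fun j =>
    ⟨Real.log _, (Real.exp_log (hpos j)).symm⟩
  choose t ht using hσ
  have hins : ∀ (j : Fin 8) (x : ℝ), (principal M (exPa j)).det = Real.exp x →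
      (principal M (insert j (exPa j))).det = Real.exp (t j + x) := fun j x hx => by
    rw [det_principal_insert M (exPa_isOrderedPerfectDAG.notMem j)
      (by rw [hx]; exact (Real.exp_pos _).ne'), hx, ht, Real.exp_add]
  have hw : M 5 5 = Real.exp (Real.log (M 5 5)) := (Real.exp_log h5).symm
  have d7 : (principal M {7}).det = Real.exp (t 7) := by
    rw [hsing, ← ht 7]
    change _ = condVar M 7 ∅
    rw [condVar, dotProduct, Finset.sum_of_isEmpty, sub_zero]
  have d5 := (hsing 5).trans hw
  have d67 := hins 6 _ d7
  have d45 := hins 4 _ d5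
  exact ⟨t, Real.log (M 5 5), ht, hw, det_principal_empty M, d5, d7, hins 5 _ d7, d67, d45,
    hins 0 _ d45, hins 1 _ d45, hins 2 _ d67, hins 3 _ d67⟩

theorem markovRatio_exOrder (θ : ShapeParam exGraph) (Γ : IncompleteMatrix exGraph) :
    markovRatio exOrder θ Γ =
      (principal Γ.toMatrix {3, 6, 7}).det ^ exAlpha θ 0 *
      (principal Γ.toMatrix {2, 6, 7}).det ^ exAlpha θ 1 *
      (principal Γ.toMatrix {5, 7}).det ^ exAlpha θ 2 *
      (principal Γ.toMatrix {1, 4, 5}).det ^ exAlpha θ 3 *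
      (principal Γ.toMatrix {0, 4, 5}).det ^ exAlpha θ 4 /
      ((principal Γ.toMatrix {6, 7}).det ^ exBeta θ 0 *
      (principal Γ.toMatrix {7}).det ^ exBeta θ 1 *
      (principal Γ.toMatrix {5}).det ^ exBeta θ 2 *
      (principal Γ.toMatrix {4, 5}).det ^ exBeta θ 3) := by
  have h0 : separatorOf exOrder.C 0 = {6, 7} := congrFun separatorOf_exCliques 0
  have h1 : separatorOf exOrder.C 1 = {7} := congrFun separatorOf_exCliques 1
  have h2 : separatorOf exOrder.C 2 = {5} := congrFun separatorOf_exCliques 2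
  have h3 : separatorOf exOrder.C 3 = {4, 5} := congrFun separatorOf_exCliques 3
  rw [markovRatio, Fin.prod_univ_five, Fin.prod_univ_four, h0, h1, h2, h3]
  rfl

theorem markovRatio_eq_prod_condVar (θ : ShapeParam exGraph) {Γ : IncompleteMatrix exGraph}
    (hΓ : Γ ∈ coneQ exGraph) :
    markovRatio exOrder θ Γ =
      (∏ j, condVar Γ.toMatrix j (exPa j) ^ exLam θ j) * Γ.toMatrix 5 5 ^ exEta θ := by
  obtain ⟨t, w, ht, hw, -, d5, d7, d57, d67, d45, d045, d145, d267, d367⟩ := exists_exp_eq_dets hΓ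
  rw [markovRatio_exOrder, Fin.prod_univ_eight]
  simp only [ht, hw, d5, d7, d57, d67, d45, d045, d145, d267, d367, ← Real.exp_mul,
    ← Real.exp_add, ← Real.exp_sub, exEta]
  congr 1
  simp [exLam]
  ring

theorem markovRatio_baseParam {Γ : IncompleteMatrix exGraph} (hΓ : Γ ∈ coneQ exGraph) :
    markovRatio exOrder (baseParam exGraph) Γ = rieszBase exPa Γ.toMatrix := by
  have hα : exAlpha (baseParam exGraph) = ![-2, -2, -3 / 2, -2, -2] := by
    have h : ∀ j, exAlpha (baseParam exGraph) j = -(((exCliques j).card : ℝ) + 1) / 2 := fun _ => rfl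
    have hc : ∀ j, (exCliques j).card = ![3, 3, 2, 3, 3] j := by decide
    ext j
    rw [h, hc]
    fin_cases j <;> norm_num
  have hβ : exBeta (baseParam exGraph) = ![-3 / 2, -1, -1, -3 / 2] := by
    have h : ∀ j, exBeta (baseParam exGraph) j =
      -(((separatorOf exCliques j).card : ℝ) + 1) / 2 := fun _ => rfl
    have hc : ∀ j, (separatorOf exCliques j).card = ![2, 1, 1, 2] j := by decide
    ext j
    rw [h, hc]
    fin_cases j <;> norm_num
  obtain ⟨t, w, ht, hw, d, d5, d7, d57, d67, d45, d045, d145, d267, d367⟩ := exists_exp_eq_dets hΓ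
  have hdet : ∀ j, (principal Γ.toMatrix (exPa j)).det =
      Real.exp (![t 4 + w, t 4 + w, t 6 + t 7, t 6 + t 7, w, t 7, t 7, 0] j) := by
    intro j
    fin_cases j
    exacts [d45, d45, d67, d67, d5, d7, d7, d.trans Real.exp_zero.symm]
  have hc : ∀ j, (exPa j).card = ![2, 2, 2, 2, 1, 1, 1, 0] j := by decide
  rw [markovRatio_exOrder, rieszBase, Fin.prod_univ_eight, hα, hβ]
  simp only [ht, hdet, hc, d5, d7, d57, d67, d45, d045, d145, d267, d367, ← Real.exp_mul,
    ← Real.exp_add, ← Real.exp_sub]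
  congr 1
  simp
  ring

end MarkovRatio

section Integrals

theorem measurable_markovRatio {V : Type*} [Fintype V] [DecidableEq V] {G : SimpleGraph V} {m : ℕ}
    (P : PerfectOrder G m) (θ : ShapeParam G) : Measurable (markovRatio P θ) := by
  have h : ∀ A : Finset V, Measurable fun Γ : IncompleteMatrix G => (principal Γ.toMatrix A).det :=
    fun A => measurable_det_of_entries fun _ _ => measurable_toMatrix_apply _ _
  exact (Finset.measurable_fun_prod _ fun j _ => (h _).pow_const _).div
    (Finset.measurable_fun_prod _ fun i _ => (h _).pow_const _)

theorem markovRatio_pos {V : Type*} [Fintype V] [DecidableEq V] {G : SimpleGraph V} {m : ℕ}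
    (P : PerfectOrder G m) (θ : ShapeParam G) {Γ : IncompleteMatrix G} (hΓ : Γ ∈ coneQ G) :
    0 < markovRatio P θ Γ := by
  have h : ∀ j, (principal Γ.toMatrix (P.C j)).PosDef := fun j => hΓ _ (P.clique j).2
  refine div_pos (Finset.prod_pos fun j _ => Real.rpow_pos_of_pos (h j).det_pos _)
    (Finset.prod_pos fun i _ => Real.rpow_pos_of_pos ?_ _)
  exact (principal_posDef_mono Finset.inter_subset_left (h i.succ)).det_pos

theorem wishartIntegral_eq_rieszIntegral {θ : ShapeParam exGraph} (hθ : exEta θ = 0)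
    (Υ : IncompleteMatrix exGraph) :
    wishartIntegral exOrder θ Υ = rieszIntegral exPa (exLam θ) Υ := by
  have hmeas : Measurable fun Γ : IncompleteMatrix exGraph =>
      ENNReal.ofReal (markovRatio exOrder (baseParam exGraph) Γ) :=
    (measurable_markovRatio _ _).ennreal_ofReal
  -- `completion` is defined by choice; this form asks measurability of the density only, not of the
  -- exponential.
  rw [wishartIntegral, muG, lintegral_withDensity_eq_lintegral_mul_non_measurable _ hmeas
    (Filter.Eventually.of_forall fun _ => ENNReal.ofReal_lt_top), rieszIntegral]
  refine setLIntegral_congr_fun exPa_isOrderedPerfectDAG.measurableSet_coneQ fun Γ hΓ => ?_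
  rw [Pi.mul_apply, ← ENNReal.ofReal_mul (markovRatio_pos _ _ hΓ).le, markovRatio_baseParam hΓ,
    markovRatio_eq_prod_condVar θ hΓ, hθ, Real.rpow_zero, mul_one, mul_comm]

theorem exists_wishartIntegral_eq {θ : ShapeParam exGraph} (hθ : exEta θ = 0)
    (hlam : ∀ j, ((exPa j).card : ℝ) / 2 < exLam θ j) :
    ∃ K : ℝ, 0 < K ∧ ∀ Υ ∈ coneQ exGraph,
      wishartIntegral exOrder θ Υ = ENNReal.ofReal (K * markovRatio exOrder θ Υ) := by
  refine ⟨∏ j, Real.Gamma (exLam θ j - ((exPa j).card : ℝ) / 2) *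
    Real.pi ^ (((exPa j).card : ℝ) / 2), Finset.prod_pos fun j _ => ?_, fun Υ hΥ => ?_⟩
  · exact mul_pos (Real.Gamma_pos_of_pos (sub_pos.2 (hlam j))) (Real.rpow_pos_of_pos Real.pi_pos _)
  · rw [wishartIntegral_eq_rieszIntegral hθ,
      exPa_isOrderedPerfectDAG.rieszIntegral_eq_ofReal hlam hΥ, markovRatio_eq_prod_condVar θ hΥ, hθ,
      Real.rpow_zero, mul_one]

theorem condA1_condA2_of_eq {V : Type*} [Fintype V] [DecidableEq V] {G : SimpleGraph V} {m : ℕ}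
    {P : PerfectOrder G m} {θ : ShapeParam G}
    (h : ∃ K : ℝ, 0 < K ∧ ∀ Υ ∈ coneQ G,
      wishartIntegral P θ Υ = ENNReal.ofReal (K * markovRatio P θ Υ)) :
    CondA1 P θ ∧ CondA2 P θ := by
  obtain ⟨K, hK, h⟩ := h
  have hdiv : ∀ Υ ∈ coneQ G,
      wishartIntegral P θ Υ / ENNReal.ofReal (markovRatio P θ Υ) = ENNReal.ofReal K := by
    intro Υ hΥ
    rw [h Υ hΥ, ENNReal.ofReal_mul hK.le, ENNReal.mul_div_cancel_right
      (ENNReal.ofReal_pos.2 (markovRatio_pos P θ hΥ)).ne' ENNReal.ofReal_ne_top]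
  refine ⟨fun Υ hΥ => ?_, fun Υ hΥ Υ' hΥ' => ?_⟩
  · rw [h Υ hΥ]
    exact ENNReal.ofReal_lt_top
  · rw [hdiv Υ hΥ, hdiv Υ' hΥ']

end Integrals

/-! ### The dimension of 𝓐 and the failure of the conjecture. -/

noncomputable section

open Classical in
/-- The shape parameters with `exEta = 0`, parametrised by `α` and `β₂, β₃, β₅`. -/
def etaZeroParam : ((CliqueIdx exGraph → ℝ) × (Fin 3 → ℝ)) →ₗ[ℝ] ShapeParam exGraph where
  toFun x := (x.1, fun S =>
    if S = exOrder.sep 0 then x.2 0 else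
    if S = exOrder.sep 1 then x.2 1 else
    if S = exOrder.sep 3 then x.2 2 else
    -- The remaining separator is S₄; this value of β₄ solves η = 0.
    x.1 (exOrder.clique 3) + x.1 (exOrder.clique 4) - x.2 2)
  map_add' x y := by
    refine Prod.ext rfl (funext fun S => ?_)
    simp only [Prod.fst_add, Prod.snd_add, Pi.add_apply]
    split_ifs <;> ring
  map_smul' c x := by
    refine Prod.ext rfl (funext fun S => ?_)
    simp only [Prod.smul_fst, Prod.smul_snd, Pi.smul_apply, RingHom.id_apply, smul_eq_mul]
    split_ifs <;> ring

theorem exOrder_sep_injective : Function.Injective exOrder.sep := by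
  have h : Function.Injective (separatorOf exCliques) := by decide
  exact fun i j hij => h (congrArg Subtype.val hij)

theorem exBeta_etaZeroParam (x : (CliqueIdx exGraph → ℝ) × (Fin 3 → ℝ)) :
    exBeta (etaZeroParam x) = ![x.2 0, x.2 1,
      x.1 (exOrder.clique 3) + x.1 (exOrder.clique 4) - x.2 2, x.2 2] := by
  ext i
  simp only [exBeta, etaZeroParam, LinearMap.coe_mk, AddHom.coe_mk, exOrder_sep_injective.eq_iff]
  fin_cases i <;> rfl

theorem eight_le_dimH_setA : 8 ≤ dimH (setA exOrder) := by
  have hfin : Module.finrank ℝ ((CliqueIdx exGraph → ℝ) × (Fin 3 → ℝ)) = 8 := by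
    rw [Module.finrank_prod, Module.finrank_fintype_fun_eq_card,
      Module.finrank_fintype_fun_eq_card, exOrder.card_cliqueIdx, Fintype.card_fin]
  let p : ShapeParam exGraph →ₗ[ℝ] (CliqueIdx exGraph → ℝ) × (Fin 3 → ℝ) :=
    (LinearMap.fst ℝ _ _).prod ((LinearMap.funLeft ℝ ℝ
      ![exOrder.sep 0, exOrder.sep 1, exOrder.sep 3]).comp (LinearMap.snd ℝ _ _))
  have hα : ∀ i, Continuous fun θ : ShapeParam exGraph => exAlpha θ i := fun i => by
    unfold exAlpha
    fun_prop
  have hβ : ∀ i, Continuous fun θ : ShapeParam exGraph => exBeta θ i := fun i => by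
    unfold exBeta
    fun_prop
  have hlam : ∀ j, Continuous fun θ : ShapeParam exGraph => exLam θ j := by
    intro j
    fin_cases j <;> simp only [exLam] <;> simp <;> fun_prop
  have ht : IsOpen {θ : ShapeParam exGraph | ∀ j, ((exPa j).card : ℝ) / 2 < exLam θ j} := by
    rw [Set.ofPred_forall]
    exact isOpen_iInter_of_finite fun j => isOpen_lt continuous_const (hlam j)
  have h := finrank_le_dimH (s := setA exOrder) etaZeroParam p (fun x => ?_) ht ?_ fun x hx => ?_
  · rw [hfin] at h
    exact_mod_cast h
  · have hb := exBeta_etaZeroParam x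
    refine Prod.ext rfl (funext fun i => ?_)
    fin_cases i
    · exact congrFun hb 0
    · exact congrFun hb 1
    · exact congrFun hb 3
  -- These values give every λ_j at least 10, while pa_j/2 is at most 1.
  · refine ⟨(fun _ => 10, fun _ => 1), fun j => ?_⟩
    have ha : exAlpha (etaZeroParam (fun _ => 10, fun _ => 1)) = fun _ => 10 := rfl
    have hc : ∀ j, (exPa j).card = ![2, 2, 2, 2, 1, 1, 1, 0] j := by decide
    have hb : exBeta (etaZeroParam (fun _ => 10, fun _ => 1)) 3 = 1 :=
      congrFun (exBeta_etaZeroParam _) 3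
    have hb0 : exBeta (etaZeroParam (fun _ => 10, fun _ => 1)) 0 = 1 :=
      congrFun (exBeta_etaZeroParam _) 0
    have hb1 : exBeta (etaZeroParam (fun _ => 10, fun _ => 1)) 1 = 1 :=
      congrFun (exBeta_etaZeroParam _) 1
    rw [exLam, ha, hb, hb0, hb1, hc]
    fin_cases j <;> norm_num
  · refine condA1_condA2_of_eq (exists_wishartIntegral_eq ?_ hx)
    rw [exEta, exBeta_etaZeroParam]
    change x.1 (exOrder.clique 3) + x.1 (exOrder.clique 4) -
      (x.1 (exOrder.clique 3) + x.1 (exOrder.clique 4) - x.2 2) - x.2 2 = 0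
    ring

end

theorem mainTheorem2 :
    -- the graph, its DAG version and the perfect order that induces it
    (IsDecomposable exGraph ∧ ¬ IsHomogeneous exGraph) ∧
    (IsDAGVersion exPa exGraph ∧ IsPerfectDAG exPa ∧ IsInducedBy exPa exOrder) ∧
    -- the Markov ratio and the base density in terms of the DAG
    (∀ Γ ∈ coneQ exGraph,
      markovRatio exOrder (baseParam exGraph) Γ = rieszBase exPa Γ.toMatrix) ∧
    (∀ (θ : ShapeParam exGraph), ∀ Γ ∈ coneQ exGraph,
      markovRatio exOrder θ Γ =
        (∏ j, condVar Γ.toMatrix j (exPa j) ^ exLam θ j) * Γ.toMatrix 5 5 ^ exEta θ) ∧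
    -- on the hyperplane the Type I Wishart integral is a generalized Riesz integral
    (∀ θ : ShapeParam exGraph, exEta θ = 0 →
      (∀ Υ ∈ coneQ exGraph,
        wishartIntegral exOrder θ Υ = rieszIntegral exPa (exLam θ) Υ ∧
        (rieszIntegral exPa (exLam θ) Υ < ∞ ↔ ∀ j, ((exPa j).card : ℝ) / 2 < exLam θ j)) ∧
      ((∀ j, ((exPa j).card : ℝ) / 2 < exLam θ j) →
        (∃ K : ℝ, 0 < K ∧ ∀ Υ ∈ coneQ exGraph,
          wishartIntegral exOrder θ Υ = ENNReal.ofReal (K * markovRatio exOrder θ Υ)) ∧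
        CondA1 exOrder θ ∧ CondA2 exOrder θ)) ∧
    -- the dimensions, and the failure of part (I) of the conjecture
    8 ≤ dimH (setA exOrder) ∧
    dimH (unionAP exGraph) = 6 ∧
    ¬ setA exOrder ⊆ unionAP exGraph ∧
    ¬ LetacMassamConjectureI := by
  have hD := exPa_isOrderedPerfectDAG
  have hdim : dimH (unionAP exGraph) = 6 := by
    rw [dimH_unionAP (m := 3) exOrder]
    norm_num
  have hnot : ¬ setA exOrder ⊆ unionAP exGraph := fun h => by
    have hle := eight_le_dimH_setA.trans (dimH_mono h)
    rw [hdim] at hle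
    exact absurd hle (by norm_num)
  refine ⟨⟨hD.isDecomposable, exGraph_not_isHomogeneous⟩,
    ⟨hD.isDAGVersion, hD.perfect, exPa_isInducedBy⟩, fun Γ hΓ => markovRatio_baseParam hΓ,
    fun θ Γ hΓ => markovRatio_eq_prod_condVar θ hΓ, fun θ hθ => ⟨fun Υ hΥ =>
      ⟨wishartIntegral_eq_rieszIntegral hθ Υ, hD.rieszIntegral_lt_top_iff _ hΥ⟩, fun hlam => ?_⟩,
    eight_le_dimH_setA, hdim, hnot, fun h => ?_⟩
  · have hK := exists_wishartIntegral_eq hθ hlam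
    exact ⟨hK, condA1_condA2_of_eq hK⟩
  · exact hnot (h 8 exGraph hD.isDecomposable exGraph_not_isHomogeneous 4 exOrder).ge
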